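/- Let $(\mathcal C,\mathbb E,\mathfrak s)$ be an extriangulated category in the sense of Nakaoka and Palu. Let $\mathbb E^1=\mathbb E$ and $\mathbb E^{i+1}(Z,A)=\int^{W}\mathbb E^{i}(W,A)\otimes\mathbb E(Z,W)$ $(i\ge 1)$ be its higher extension bifunctors. Classes of objects of $\mathcal C$ are written $\mathcal X,\mathcal T,\dots$, and $A\to B\to Z\dashrightarrow$ denotes an $\mathbb E$-triangle. We use the following notions. - $\operatorname{smd}(\mathcal X)$ is the class of direct summands of objects of $\mathcal X$, i.e. of the objects $N$ for which there are $M\in\mathcal X$ and morphisms $i:N\to M$, $p:M\to N$ with $pi=1_N$. $\mathcal X$ is closed under extensions if $A,Z\in\mathcal X$ implies $B\in\mathcal X$ for every $\mathbb E$-triangle $A\to B\to Z\dashrightarrow$. - $\mathcal T^{\perp}$ is the class of all $A$ with $\mathbb E^i(Z,A)=0$ for all $Z\in\mathcal T$ and $i\ge 1$. - $\operatorname{pd}_{\mathcal X}(\mathcal T)=\sup_{Z\in\mathcal T}\operatorname{pd}_{\mathcal X}(Z)$, where $\operatorname{pd}_{\mathcal X}(Z)\in\mathbb N\cup\{\infty\}$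 is the least $m$ with $\mathbb E^k(Z,A)=0$ for all $k>m$ and $A\in\mathcal X$. - $\omega$ is a relative generator in $\mathcal X$ if $\omega\subseteq\mathcal X$ and each $Z\in\mathcal X$ has an $\mathbb E$-triangle $X'\to W\to Z\dashrightarrow$ with $W\in\omega$, $X'\in\mathcal X$. Dually, $\alpha$ is a relative cogenerator in $\mathcal X$ if $\alpha\subseteq\mathcal X$ and each $Z\in\mathcal X$ has an $\mathbb E$-triangle $Z\to W\to X'\dashrightarrow$ with $W\in\alpha$, $X'\in\mathcal X$. - $\mathcal T^{\vee}_{\mathcal X}$ is the class of all $M$ for which there are $m\ge 0$ and $\mathbb E$-triangles $N_{j-1}\to T_j\to N_j\dashrightarrow$ $(0\le j\le m-1)$ with $N_{-1}=M$, $T_j\in\mathcal T$, $N_j\in\mathcal X$ for $0\le j\le m-1$, and $N_{m-1}\cong T_m$ for some $T_m\in\mathcal T\cap\mathcal X$. - A $\mathcal T$-precover of $Z$ is a morphism $f:T'\to Z$ with $T'\in\mathcal T$ through which every morphism $T''\to Z$ with $T''\in\mathcal T$ factors. - For $n\ge 1$, $\operatorname{Fac}^{\mathcal X}_n(\mathcal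 T)$ is the class of all $B$ for which there are $\mathbb E$-triangles $K_j\to T_j\to K_{j-1}\dashrightarrow$ $(1\le j\le n)$ with $K_0=B$, $T_j\in\mathcal T\cap\mathcal X$ and $K_j\in\mathcal X$ for $1\le j\le n$. - For $n\ge 1$, a class $\mathcal Y\subseteq\mathcal X$ is closed by $n$-quotients in $\mathcal X$ if $B\in\mathcal Y$ whenever $B\in\mathcal X$ and there are $\mathbb E$-triangles $K_j\to Y_j\to K_{j-1}\dashrightarrow$ $(1\le j\le n)$ with $K_0=B$, $Y_j\in\mathcal Y$ and $K_j\in\mathcal X$ for $1\le j\le n$. - $\mathcal T$ is $n$-$\mathcal X$-tilting if: (T0) $\mathcal T=\operatorname{smd}(\mathcal T)$; (T1) $\operatorname{pd}_{\mathcal X}(\mathcal T)\le n$; (T2) $\mathcal T\cap\mathcal X\subseteq\mathcal T^{\perp}$; (T3) some class $\omega\subseteq\mathcal T^{\vee}_{\mathcal X}$ is a relative generator in $\mathcal X$; (T4) some class $\alpha\subseteq\mathcal X^{\perp}\cap\mathcal T^{\perp}$ is a relative cogenerator in $\mathcal X$; (T5) every $Z\in\mathcal X\cap\mathcal T^{\perp}$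 has a $\mathcal T$-precover $T'\to Z$ with $T'\in\mathcal X$. **Theorem.** Let $n\ge 1$, let $\mathcal X=\operatorname{smd}(\mathcal X)$ be closed under extensions, and let $\mathcal T=\operatorname{smd}(\mathcal T)$ satisfy (T4) and (T5). Then the following conditions are equivalent: 1. $\mathcal T$ is $n$-$\mathcal X$-tilting; 2. $\operatorname{Fac}^{\mathcal X}_n(\mathcal T)\cap\mathcal X=\mathcal T^{\perp}\cap\mathcal X$; 3. $\mathcal T^{\perp}\cap\mathcal X=\operatorname{Fac}^{\mathcal X}_k(\mathcal T)\cap\mathcal X$ for all $k\ge n$; 4. $\mathcal T^{\perp}\cap\mathcal X$ is closed by $n$-quotients in $\mathcal X$, and $\mathcal T\cap\mathcal X\subseteq\mathcal T^{\perp}\cap\mathcal X\subseteq\operatorname{Fac}^{\mathcal X}_1(\mathcal T)$. -/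

import Mathlib

open CategoryTheory CategoryTheory.Limits Opposite

universe w v u

namespace Extri

section Bifunctor

variable {C : Type u} [Category.{v} C] (E : Cᵒᵖ ⥤ C ⥤ AddCommGrpCat.{w})

/-- The group `𝔼(Z, A)` of extensions of `Z` by `A`. -/
abbrev Extn (Z A : C) : Type w := (E.obj (op Z)).obj A

/-- The pull-back `c^* : 𝔼(Z, A) → 𝔼(Z', A)` along `c : Z' ⟶ Z`. -/
def pull {Z' Z : C} (c : Z' ⟶ Z) (A : C) : Extn E Z A →+ Extn E Z' A :=
  ((E.map c.op).app A).hom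

/-- The push-forward `a_* : 𝔼(Z, A) → 𝔼(Z, A')` along `a : A ⟶ A'`. -/
def push {A A' : C} (a : A ⟶ A') (Z : C) : Extn E Z A →+ Extn E Z A' :=
  ((E.obj (op Z)).map a).hom

/-! ### Higher extension groups

For a contravariant functor `F`, the functor `F ⋄ 𝔼` is the coend
`Z ↦ ∫^X F(X) ⊗ 𝔼(Z, X)`, given by generators `x ⊗ δ` and relations. -/

variable (F : Cᵒᵖ ⥤ AddCommGrpCat.{max u w})

/-- Generators of `(F ⋄ 𝔼)(Z)`: pairs `(x, δ)` with `x ∈ F(X)` and `δ ∈ 𝔼(Z, X)` for some `X`. -/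
abbrev CoendGen (Z : C) : Type (max u w) := Σ X : C, F.obj (op X) × Extn E Z X

/-- Relations of `(F ⋄ 𝔼)(Z)`: biadditivity of `x ⊗ δ`, and `f^* x ⊗ δ = x ⊗ f_* δ`. -/
inductive CoendRel (Z : C) : FreeAbelianGroup (CoendGen E F Z) → Prop
  | add_left (X : C) (x x' : F.obj (op X)) (δ : Extn E Z X) :
      CoendRel Z (FreeAbelianGroup.of ⟨X, x + x', δ⟩
        - FreeAbelianGroup.of ⟨X, x, δ⟩ - FreeAbelianGroup.of ⟨X, x', δ⟩)
  | add_right (X : C) (x : F.obj (op X)) (δ δ' : Extn E Z X) :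
      CoendRel Z (FreeAbelianGroup.of ⟨X, x, δ + δ'⟩
        - FreeAbelianGroup.of ⟨X, x, δ⟩ - FreeAbelianGroup.of ⟨X, x, δ'⟩)
  | balanced {X Y : C} (f : X ⟶ Y) (x : F.obj (op Y)) (δ : Extn E Z X) :
      CoendRel Z (FreeAbelianGroup.of ⟨X, (F.map f.op).hom x, δ⟩
        - FreeAbelianGroup.of ⟨Y, x, push E f Z δ⟩)

/-- The subgroup generated by the relations. -/
def coendRelSubgroup (Z : C) : AddSubgroup (FreeAbelianGroup (CoendGen E F Z)) :=
  AddSubgroup.closure {r | CoendRel E F Z r}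

/-- The group `(F ⋄ 𝔼)(Z)`. -/
abbrev CoendObj (Z : C) : Type (max u w) :=
  FreeAbelianGroup (CoendGen E F Z) ⧸ coendRelSubgroup E F Z

/-- The map on generators `x ⊗ δ ↦ x ⊗ c^* δ`. -/
def coendGenMap {Z' Z : C} (c : Z' ⟶ Z) :
    FreeAbelianGroup (CoendGen E F Z) →+ FreeAbelianGroup (CoendGen E F Z') :=
  FreeAbelianGroup.map fun g => ⟨g.1, g.2.1, pull E c g.1 g.2.2⟩

theorem pull_push {Z' Z A A' : C} (c : Z' ⟶ Z) (a : A ⟶ A') (δ : Extn E Z A) :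
    pull E c A' (push E a Z δ) = push E a Z' (pull E c A δ) :=
  (ConcreteCategory.congr_hom ((E.map c.op).naturality a) δ)

theorem pull_id (Z A : C) (δ : Extn E Z A) : pull E (𝟙 Z) A δ = δ := by
  simp [pull]

theorem pull_comp {Z'' Z' Z : C} (c' : Z'' ⟶ Z') (c : Z' ⟶ Z) (A : C) (δ : Extn E Z A) :
    pull E (c' ≫ c) A δ = pull E c' A (pull E c A δ) := by
  simp [pull]

theorem coendGenMap_of {Z' Z : C} (c : Z' ⟶ Z) (X : C) (x : F.obj (op X)) (δ : Extn E Z X) :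
    coendGenMap E F c (FreeAbelianGroup.of ⟨X, x, δ⟩)
      = FreeAbelianGroup.of ⟨X, x, pull E c X δ⟩ :=
  FreeAbelianGroup.map_of_apply _

theorem coendRelSubgroup_le {Z' Z : C} (c : Z' ⟶ Z) :
    coendRelSubgroup E F Z ≤ (coendRelSubgroup E F Z').comap (coendGenMap E F c) := by
  rw [coendRelSubgroup, AddSubgroup.closure_le]
  intro r hr
  refine AddSubgroup.subset_closure (?_ : CoendRel E F Z' (coendGenMap E F c r))
  cases hr with
  | add_left X x x' δ =>
    simp only [map_sub, coendGenMap_of]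
    exact CoendRel.add_left X x x' _
  | add_right X x δ δ' =>
    simp only [map_sub, coendGenMap_of, map_add]
    exact CoendRel.add_right X x _ _
  | balanced f x δ =>
    simp only [map_sub, coendGenMap_of, pull_push]
    exact CoendRel.balanced f x _

/-- The map `c^* : (F ⋄ 𝔼)(Z) → (F ⋄ 𝔼)(Z')`. -/
def coendMap {Z' Z : C} (c : Z' ⟶ Z) : CoendObj E F Z →+ CoendObj E F Z' :=
  QuotientAddGroup.map _ _ (coendGenMap E F c) (coendRelSubgroup_le E F c)

theorem coendMap_id (Z : C) : coendMap E F (𝟙 Z) = AddMonoidHom.id _ := by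
  refine QuotientAddGroup.addMonoidHom_ext _ (FreeAbelianGroup.lift_ext _ _ ?_)
  rintro ⟨X, x, δ⟩
  change QuotientAddGroup.mk (coendGenMap E F (𝟙 Z) (FreeAbelianGroup.of ⟨X, x, δ⟩)) = _
  rw [coendGenMap_of, pull_id]
  rfl

theorem coendMap_comp {Z'' Z' Z : C} (c' : Z'' ⟶ Z') (c : Z' ⟶ Z) :
    coendMap E F (c' ≫ c) = (coendMap E F c').comp (coendMap E F c) := by
  refine QuotientAddGroup.addMonoidHom_ext _ (FreeAbelianGroup.lift_ext _ _ ?_)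
  rintro ⟨X, x, δ⟩
  change QuotientAddGroup.mk (coendGenMap E F (c' ≫ c) (FreeAbelianGroup.of ⟨X, x, δ⟩)) =
    QuotientAddGroup.mk
      (coendGenMap E F c' (coendGenMap E F c (FreeAbelianGroup.of ⟨X, x, δ⟩)))
  rw [coendGenMap_of, coendGenMap_of, coendGenMap_of, pull_comp]

/-- The functor `F ⋄ 𝔼 : Z ↦ ∫^X F(X) ⊗ 𝔼(Z, X)`. -/
def coendFunctor : Cᵒᵖ ⥤ AddCommGrpCat.{max u w} where
  obj Z := AddCommGrpCat.of (CoendObj E F Z.unop)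
  map c := AddCommGrpCat.ofHom (coendMap E F c.unop)
  map_id Z := by
    rw [unop_id, coendMap_id]; rfl
  map_comp c c' := by
    rw [unop_comp, coendMap_comp]; rfl

/-- The higher extension functors in their first argument, with a shift of the index:
`posExt E A i` is `𝔼^{i+1}(-, A)`, where `𝔼^1 = 𝔼` and `𝔼^{m+1} = 𝔼^m ⋄ 𝔼`. -/
def posExt (A : C) : ℕ → (Cᵒᵖ ⥤ AddCommGrpCat.{max u w})
  | 0 => E.flip.obj A ⋙ AddCommGrpCat.uliftFunctor.{u, w}
  | i + 1 => coendFunctor E (posExt A i)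

/-- `𝔼^{i+1}(Z, A) = 0`. -/
def SuccExtVanishes (i : ℕ) (Z A : C) : Prop :=
  Subsingleton ((posExt E A i).obj (op Z))

/-- The right orthogonal class `𝒯^⊥`: the objects `A` with `𝔼^i(Z, A) = 0` for all `Z` in `𝒯`
and all `i ≥ 1`. -/
def rightPerp (T : ObjectProperty C) : ObjectProperty C :=
  fun A => ∀ (i : ℕ) (Z : C), T Z → SuccExtVanishes E i Z A

/-- The relative projective dimension `pd_𝒳(Z)`, the least `n` such that `𝔼^k(Z, A) = 0` for all
`k > n` and all `A` in `𝒳`, and `∞` if there is no such `n`. -/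
noncomputable def pdObj (X : ObjectProperty C) (Z : C) : ℕ∞ :=
  ⨅ (n : ℕ) (_ : ∀ i : ℕ, n < i + 1 → ∀ A : C, X A → SuccExtVanishes E i Z A), (n : ℕ∞)

/-- The relative projective dimension `pd_𝒳(𝒯) = sup {pd_𝒳(Z) | Z ∈ 𝒯}` of a class. -/
noncomputable def pd (X T : ObjectProperty C) : ℕ∞ :=
  ⨆ (Z : C) (_ : T Z), pdObj E X Z

end Bifunctor

/-- `f : T' ⟶ Z` is a `𝒯`-precover of `Z`. -/
def IsPrecover {C : Type u} [Category.{v} C] (T : ObjectProperty C) {T' Z : C} (f : T' ⟶ Z) :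
    Prop :=
  T T' ∧ ∀ T'' : C, T T'' → ∀ g : T'' ⟶ Z, ∃ h : T'' ⟶ T', h ≫ f = g

section Extriangulation

variable {C : Type u} [Category.{v} C] [Preadditive C] [HasZeroObject C] [HasBinaryBiproducts C]

/-- The direct sum `δ ⊕ δ' ∈ 𝔼(Z ⊕ Z', A ⊕ A')`, the element with components `(δ, 0, 0, δ')`. -/
noncomputable def extSum (E : Cᵒᵖ ⥤ C ⥤ AddCommGrpCat.{w}) {Z A Z' A' : C}
    (δ : Extn E Z A) (δ' : Extn E Z' A') : Extn E (Z ⊞ Z') (A ⊞ A') :=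
  push E biprod.inl _ (pull E biprod.fst A δ) + push E biprod.inr _ (pull E biprod.snd A' δ')

/-- The structure of an extriangulated category with extension bifunctor `E` on the additive
category `C`. The proposition `Real x y δ` says that the sequence `A ⟶ B ⟶ Z` given by `x`, `y`
belongs to the class `𝔰(δ)`, that is, that `A ⟶ B ⟶ Z ⇢ δ` is an `𝔼`-triangle. -/
structure Extriangulation (E : Cᵒᵖ ⥤ C ⥤ AddCommGrpCat.{w}) where
  /-- (ET1) `𝔼` is additive in the second argument. -/
  additive_right : ∀ Z : Cᵒᵖ, (E.obj Z).Additive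
  /-- (ET1) `𝔼` is additive in the first argument. -/
  additive_left : ∀ A : C, (E.flip.obj A).Additive
  /-- The `𝔼`-triangles. -/
  Real : ∀ {A B Z : C}, (A ⟶ B) → (B ⟶ Z) → Extn E Z A → Prop
  /-- `𝔰(δ)` is not empty. -/
  exists_real : ∀ {A Z : C} (δ : Extn E Z A), ∃ (B : C) (x : A ⟶ B) (y : B ⟶ Z), Real x y δ
  /-- `𝔰(δ)` is closed under equivalence of sequences. -/
  real_of_iso : ∀ {A B B' Z : C} {x : A ⟶ B} {y : B ⟶ Z} {δ : Extn E Z A} (e : B ≅ B'),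
    Real x y δ → Real (x ≫ e.hom) (e.inv ≫ y) δ
  /-- Any two sequences in `𝔰(δ)` are equivalent. -/
  real_unique : ∀ {A B B' Z : C} {x : A ⟶ B} {y : B ⟶ Z} {x' : A ⟶ B'} {y' : B' ⟶ Z}
    {δ : Extn E Z A}, Real x y δ → Real x' y' δ →
    ∃ e : B ≅ B', x ≫ e.hom = x' ∧ e.hom ≫ y' = y
  /-- (ET2) `𝔰` is a realization: morphisms of extensions lift to morphisms of sequences. -/
  real_lift : ∀ {A B Z A' B' Z' : C} {x : A ⟶ B} {y : B ⟶ Z} {δ : Extn E Z A}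
    {x' : A' ⟶ B'} {y' : B' ⟶ Z'} {δ' : Extn E Z' A'}, Real x y δ → Real x' y' δ' →
    ∀ (a : A ⟶ A') (c : Z ⟶ Z'), push E a Z δ = pull E c A' δ' →
    ∃ b : B ⟶ B', x ≫ b = a ≫ x' ∧ y ≫ c = b ≫ y'
  /-- (ET2) `𝔰(0)` is the split sequence. -/
  real_zero : ∀ A Z : C,
    Real (biprod.inl : A ⟶ A ⊞ Z) (biprod.snd : A ⊞ Z ⟶ Z) (0 : Extn E Z A)
  /-- (ET2) `𝔰(δ ⊕ δ') = 𝔰(δ) ⊕ 𝔰(δ')`. -/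
  real_sum : ∀ {A B Z A' B' Z' : C} {x : A ⟶ B} {y : B ⟶ Z} {δ : Extn E Z A}
    {x' : A' ⟶ B'} {y' : B' ⟶ Z'} {δ' : Extn E Z' A'}, Real x y δ → Real x' y' δ' →
    Real (biprod.map x x') (biprod.map y y') (extSum E δ δ')
  /-- (ET3). -/
  et3 : ∀ {A B Z A' B' Z' : C} {x : A ⟶ B} {y : B ⟶ Z} {δ : Extn E Z A}
    {x' : A' ⟶ B'} {y' : B' ⟶ Z'} {δ' : Extn E Z' A'}, Real x y δ → Real x' y' δ' →
    ∀ (a : A ⟶ A') (b : B ⟶ B'), x ≫ b = a ≫ x' →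
    ∃ c : Z ⟶ Z', y ≫ c = b ≫ y' ∧ push E a Z δ = pull E c A' δ'
  /-- The dual of (ET3). -/
  et3_op : ∀ {A B Z A' B' Z' : C} {x : A ⟶ B} {y : B ⟶ Z} {δ : Extn E Z A}
    {x' : A' ⟶ B'} {y' : B' ⟶ Z'} {δ' : Extn E Z' A'}, Real x y δ → Real x' y' δ' →
    ∀ (b : B ⟶ B') (c : Z ⟶ Z'), y ≫ c = b ≫ y' →
    ∃ a : A ⟶ A', x ≫ b = a ≫ x' ∧ push E a Z δ = pull E c A' δ'
  /-- (ET4). -/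
  et4 : ∀ {A B D G H : C} {f : A ⟶ B} {f' : B ⟶ D} {δ : Extn E D A}
    {g : B ⟶ G} {g' : G ⟶ H} {δ' : Extn E H B}, Real f f' δ → Real g g' δ' →
    ∃ (K : C) (d : D ⟶ K) (e : K ⟶ H) (h' : G ⟶ K) (δ'' : Extn E K A),
      Real (f ≫ g) h' δ'' ∧ f' ≫ d = g ≫ h' ∧ h' ≫ e = g' ∧
      Real d e (push E f' H δ') ∧ pull E d A δ'' = δ ∧ push E f K δ'' = pull E e B δ'
  /-- The dual of (ET4). -/
  et4_op : ∀ {D A B H G : C} {f' : D ⟶ A} {f : A ⟶ B} {δ : Extn E B D}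
    {g' : H ⟶ B} {g : B ⟶ G} {δ' : Extn E G H}, Real f' f δ → Real g' g δ' →
    ∃ (K : C) (d : D ⟶ K) (e : K ⟶ H) (h' : K ⟶ A) (δ'' : Extn E G K),
      Real h' (f ≫ g) δ'' ∧ d ≫ h' = f' ∧ h' ≫ f = e ≫ g' ∧
      Real d e (pull E g' D δ) ∧ push E e G δ'' = δ' ∧ push E d B δ = pull E g K δ''

namespace Extriangulation

variable {E : Cᵒᵖ ⥤ C ⥤ AddCommGrpCat.{w}} (s : Extriangulation E)

/-- There is an `𝔼`-triangle `A ⟶ B ⟶ Z ⇢`. -/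
def Tri (A B Z : C) : Prop :=
  ∃ (x : A ⟶ B) (y : B ⟶ Z) (δ : Extn E Z A), s.Real x y δ

/-- `𝒳` is closed under extensions. -/
def ClosedUnderExtensions (X : ObjectProperty C) : Prop :=
  ∀ A B Z : C, s.Tri A B Z → X A → X Z → X B

/-- `ω` is a relative generator in `𝒳`. -/
def IsRelGenerator (X ω : ObjectProperty C) : Prop :=
  ω ≤ X ∧ ∀ Z : C, X Z → ∃ X' W : C, s.Tri X' W Z ∧ ω W ∧ X X'

/-- `α` is a relative cogenerator in `𝒳`. -/
def IsRelCogenerator (X α : ObjectProperty C) : Prop :=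
  α ≤ X ∧ ∀ Z : C, X Z → ∃ W X' : C, s.Tri Z W X' ∧ α W ∧ X X'

/-- The class `𝒴^∨_𝒳` of the objects `M` with a finite `𝒴_𝒳`-coresolution
`M ⟶ Y₀ ⟶ ⋯ ⟶ Yₙ`, glued from `𝔼`-triangles `M ⟶ Y₀ ⟶ N₀`, `N₀ ⟶ Y₁ ⟶ N₁`, …,
`Nₙ₋₂ ⟶ Yₙ₋₁ ⟶ Nₙ₋₁ ≅ Yₙ` with `Yₖ ∈ 𝒴`, `Nₖ ∈ 𝒳` for `k < n` and `Yₙ ∈ 𝒳 ∩ 𝒴`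
(for `n = 0` this means `M ≅ Y₀ ∈ 𝒳 ∩ 𝒴`). -/
inductive FinCores (X Y : ObjectProperty C) : C → Prop
  | base {M Y₀ : C} (i : M ≅ Y₀) (hX : X Y₀) (hY : Y Y₀) : FinCores X Y M
  | step {M Y₀ N₀ : C} (h : s.Tri M Y₀ N₀) (hY : Y Y₀) (hX : X N₀)
      (hN : FinCores X Y N₀) : FinCores X Y M

/-- `LeftRes X Y n B` : there is a complex `Kₙ ⟶ Yₙ ⟶ ⋯ ⟶ Y₁ ⟶ B` glued from `𝔼`-triangles
`K₁ ⟶ Y₁ ⟶ B`, `K₂ ⟶ Y₂ ⟶ K₁`, …, `Kₙ ⟶ Yₙ ⟶ Kₙ₋₁` with all `Yᵢ ∈ 𝒴` and all `Kᵢ ∈ 𝒳`. -/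
def LeftRes (X Y : ObjectProperty C) : ℕ → ObjectProperty C
  | 0, _ => True
  | n + 1, B => ∃ K₁ Y₁ : C, s.Tri K₁ Y₁ B ∧ Y Y₁ ∧ X K₁ ∧ LeftRes X Y n K₁

/-- The class `Fac^𝒳_n(𝒯)` (for `n ≥ 1`). -/
def Fac (X T : ObjectProperty C) (n : ℕ) : ObjectProperty C :=
  s.LeftRes X (T ⊓ X) n

/-- `𝒴 ⊆ 𝒳` is closed by `n`-quotients in `𝒳` (for `n ≥ 1`). -/
def ClosedByQuotients (n : ℕ) (X Y : ObjectProperty C) : Prop :=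
  Y ≤ X ∧ ∀ B : C, X B → s.LeftRes X Y n B → Y B

/-- (T3): some class `ω ⊆ 𝒯^∨_𝒳` is a relative generator in `𝒳`. -/
def T3 (X T : ObjectProperty C) : Prop :=
  ∃ ω : ObjectProperty C, ω ≤ s.FinCores X T ∧ s.IsRelGenerator X ω

/-- (T4): some class `α ⊆ 𝒳^⊥ ∩ 𝒯^⊥` is a relative cogenerator in `𝒳`. -/
def T4 (X T : ObjectProperty C) : Prop :=
  ∃ α : ObjectProperty C, α ≤ rightPerp E X ⊓ rightPerp E T ∧ s.IsRelCogenerator X α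

end Extriangulation

/-- (T5): every `Z ∈ 𝒳 ∩ 𝒯^⊥` has a `𝒯`-precover `T' ⟶ Z` with `T' ∈ 𝒳`. -/
def T5 (E : Cᵒᵖ ⥤ C ⥤ AddCommGrpCat.{w}) (X T : ObjectProperty C) : Prop :=
  ∀ Z : C, X Z → rightPerp E T Z → ∃ (T' : C) (f : T' ⟶ Z), IsPrecover T f ∧ X T'

/-- `𝒯` is an `n`-`𝒳`-tilting class. -/
structure Extriangulation.IsTilting {E : Cᵒᵖ ⥤ C ⥤ AddCommGrpCat.{w}} (s : Extriangulation E)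
    (n : ℕ) (X T : ObjectProperty C) : Prop where
  /-- (T0): `𝒯 = smd(𝒯)`. -/
  t0 : T = T.retractClosure
  /-- (T1): `pd_𝒳(𝒯) ≤ n`. -/
  t1 : pd E X T ≤ n
  /-- (T2): `𝒯 ∩ 𝒳 ⊆ 𝒯^⊥`. -/
  t2 : T ⊓ X ≤ rightPerp E T
  t3 : s.T3 X T
  t4 : s.T4 X T
  t5 : T5 E X T

end Extriangulation

end Extri

set_option linter.unusedSectionVars false

/-! All four conditions pass through `PerpIsFac`. Given its inclusions, adding a `𝒯`-precover to a
deflation from `𝒯 ∩ 𝒳` makes every object of `𝒯^⊥ ∩ 𝒳` a quotient of an object of `𝒯 ∩ 𝒳` with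
kernel again in `𝒯^⊥ ∩ 𝒳` (`exists_special_precover`). Iterating gives `Fac_k` for all `k`;
substituting into resolutions gives closure under `n`-quotients (`fac_of_leftRes`).

For tilting `𝒯`, dimension shifting along `n` steps and `pd ≤ n` put `Fac_n ∩ 𝒳` in `𝒯^⊥`. If `M ∈
𝒯^⊥ ∩ 𝒳` is covered by `W` from (T3), and `W ⟶ T₀ ⟶ N` starts a coresolution, then `𝔼(N, M) = 0`
(`extn_subsingleton_of_finCores`), so a pushout splits and `T₀` maps onto `M`.

Conversely, (T4) gives cosyzygies of any `A ∈ 𝒳` through objects of `𝒯^⊥ ∩ 𝒳`. The `n`-th is an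
`n`-quotient, hence lies in `𝒯^⊥`; shifting back bounds `pd`, and pulling its special precover back
step by step covers `A` by a finitely coresolved object (`exists_finCores_cover`).

Dimension shifting needs long exact sequences for the coend-defined `𝔼^i` without enough projectives
or injectives. The key is `refinesToZero_of_tmul_eq_zero`: if `x ⊗ δ = 0`, then `δ` lifts along a
map that kills `x`. Exactness therefore survives `- ⋄ 𝔼`. -/

namespace Extri

section BifunctorLemmas

variable {C : Type u} [Category.{v} C] (E : Cᵒᵖ ⥤ C ⥤ AddCommGrpCat.{w})

theorem push_id (Z A : C) (δ : Extn E Z A) : push E (𝟙 A) Z δ = δ := by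
  simp [push]

theorem push_comp {A A' A'' : C} (a : A ⟶ A') (a' : A' ⟶ A'') (Z : C) (δ : Extn E Z A) :
    push E (a ≫ a') Z δ = push E a' Z (push E a Z δ) := by
  simp [push]

end BifunctorLemmas

/-! ### Six-term exactness and diagram constructions for `𝔼`-triangles. -/

section ExtriangulationLemmas

variable {C : Type u} [Category.{v} C] [Preadditive C] [HasZeroObject C] [HasBinaryBiproducts C]
  {E : Cᵒᵖ ⥤ C ⥤ AddCommGrpCat.{w}}

namespace Extriangulation

theorem push_add (s : Extriangulation E) {A A' : C} (a b : A ⟶ A') {Z : C} (δ : Extn E Z A) :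
    push E (a + b) Z δ = push E a Z δ + push E b Z δ := by
  have := s.additive_right (op Z)
  simp [push, Functor.map_add]

theorem pull_add (s : Extriangulation E) {Z Z' : C} (a b : Z' ⟶ Z) {A : C} (δ : Extn E Z A) :
    pull E (a + b) A δ = pull E a A δ + pull E b A δ := by
  have := s.additive_left A
  have h := (E.flip.obj A).map_add (f := a.op) (g := b.op)
  exact ConcreteCategory.congr_hom h δ

theorem push_zero (s : Extriangulation E) {A A' : C} {Z : C} (δ : Extn E Z A) :
    push E (0 : A ⟶ A') Z δ = 0 := by
  have h := s.push_add (0 : A ⟶ A') 0 δ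
  simpa using h

theorem pull_zero (s : Extriangulation E) {Z Z' : C} {A : C} (δ : Extn E Z A) :
    pull E (0 : Z' ⟶ Z) A δ = 0 := by
  have h := s.pull_add (0 : Z' ⟶ Z) 0 δ
  simpa using h

theorem push_sub (s : Extriangulation E) {A A' : C} (a b : A ⟶ A') {Z : C} (δ : Extn E Z A) :
    push E (a - b) Z δ = push E a Z δ - push E b Z δ := by
  rw [eq_sub_iff_add_eq, ← s.push_add, sub_add_cancel]

variable {s : Extriangulation E} {A B Z : C} {x : A ⟶ B} {y : B ⟶ Z} {δ : Extn E Z A}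

theorem comp_eq_zero (h : s.Real x y δ) : x ≫ y = 0 := by
  obtain ⟨c, hc, -⟩ := s.et3 (s.real_zero A Z) h (𝟙 A) (biprod.fst ≫ x) (by simp)
  have := congrArg (fun t => (biprod.inl : A ⟶ A ⊞ Z) ≫ t) hc
  simpa using this.symm

theorem pull_deflation (h : s.Real x y δ) : pull E y A δ = 0 := by
  obtain ⟨a, -, ha⟩ := s.et3_op (s.real_zero A B) h biprod.snd y rfl
  rw [← ha, map_zero]

theorem exists_inflation_comp_eq (h : s.Real x y δ) {W : C} (f : A ⟶ W)
    (hf : push E f Z δ = 0) : ∃ g : B ⟶ W, x ≫ g = f := by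
  obtain ⟨b, hb, -⟩ := s.real_lift h (s.real_zero W Z) f (𝟙 Z) (by rw [hf, map_zero])
  refine ⟨b ≫ biprod.fst, ?_⟩
  rw [← Category.assoc, hb]
  simp

theorem exists_comp_deflation_eq (h : s.Real x y δ) {W : C} (f : W ⟶ Z)
    (hf : pull E f A δ = 0) : ∃ g : W ⟶ B, g ≫ y = f := by
  obtain ⟨b, -, hb⟩ := s.real_lift (s.real_zero A W) h (𝟙 A) f (by rw [hf, map_zero])
  refine ⟨biprod.inr ≫ b, ?_⟩
  rw [Category.assoc, ← hb]
  simp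

theorem exists_deflation_comp_eq (h : s.Real x y δ) {W : C} (f : B ⟶ W)
    (hf : x ≫ f = 0) : ∃ g : Z ⟶ W, y ≫ g = f := by
  obtain ⟨c, hc, -⟩ := s.et3 h (s.real_zero W W) 0 (f ≫ biprod.inr) (by
    rw [← Category.assoc, hf]; simp)
  exact ⟨c, by simpa using hc⟩

/-- Exactness of `Hom(Y, Z) → 𝔼(Y, A) → 𝔼(Y, B)`. -/
theorem exists_pull_eq (h : s.Real x y δ) {Y : C} (ε : Extn E Y A)
    (hε : push E x Y ε = 0) : ∃ c : Y ⟶ Z, pull E c A δ = ε := by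
  obtain ⟨V, i, p, hV⟩ := s.exists_real ε
  obtain ⟨b, hb⟩ := exists_inflation_comp_eq hV x hε
  obtain ⟨c, -, hc⟩ := s.et3 hV h (𝟙 A) b (by rw [hb, Category.id_comp])
  exact ⟨c, by rw [← hc, push_id]⟩

/-- Exactness of `Hom(A, Y) → 𝔼(Z, Y) → 𝔼(B, Y)`. -/
theorem exists_push_eq (h : s.Real x y δ) {Y : C} (ε : Extn E Z Y)
    (hε : pull E y Y ε = 0) : ∃ a : A ⟶ Y, push E a Z δ = ε := by
  obtain ⟨V, i, p, hV⟩ := s.exists_real ε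
  obtain ⟨b, hb⟩ := exists_comp_deflation_eq hV y hε
  obtain ⟨a, -, ha⟩ := s.et3_op h hV b (𝟙 Z) (by rw [hb, Category.comp_id])
  exact ⟨a, by rw [ha, pull_id]⟩

/-- Exactness of `𝔼(Y, A) → 𝔼(Y, B) → 𝔼(Y, Z)`. -/
theorem exists_push_inflation_eq (h : s.Real x y δ) {Y : C} (ε : Extn E Y B)
    (hε : push E y Y ε = 0) : ∃ ε' : Extn E Y A, push E x Y ε' = ε := by
  obtain ⟨V, i, p, hV⟩ := s.exists_real ε
  obtain ⟨K, d, e, h', δ'', -, -, -, hK, -, h2⟩ := s.et4 h hV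
  -- The triangle `Z ⟶ K ⟶ Y` realizes `y_* ε = 0`, so `e` has a section `t`; pulling `δ''` back
  -- along it gives the preimage.
  obtain ⟨t, ht⟩ := exists_comp_deflation_eq hK (𝟙 Y) (by rw [hε, map_zero])
  refine ⟨pull E t A δ'', ?_⟩
  rw [← pull_push, h2, ← pull_comp, ht, pull_id]

/-- Endomorphisms of an `𝔼`-triangle that are the identity on both ends are isomorphisms. -/
theorem isIso_of_endo (h : s.Real x y δ) (b : B ⟶ B) (hx : x ≫ b = x) (hy : b ≫ y = y) :
    IsIso b := by
  obtain ⟨m, hm⟩ := exists_deflation_comp_eq h (b - 𝟙 B) (by simp [hx])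
  have hn : (b - 𝟙 B) ≫ y = 0 := by simp [hy]
  -- The difference `b - 1` factors through `y` and is killed by `y`, so it squares to zero and `1 -
  -- (b - 1)` inverts `b`.
  have hsq : (b - 𝟙 B) ≫ (b - 𝟙 B) = 0 := by
    rw [← hm] at hn ⊢
    rw [← Category.assoc, hn, zero_comp]
  have e1 : b = 𝟙 B + (b - 𝟙 B) := by abel
  refine ⟨𝟙 B - (b - 𝟙 B), ?_, ?_⟩
  · conv_lhs => rw [e1]
    generalize b - 𝟙 B = n at hsq
    simp [hsq]
  · conv_lhs => rw [e1]
    generalize b - 𝟙 B = n at hsq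
    simp [hsq]

/-- A morphism of `𝔼`-triangles that is invertible on both ends is invertible. -/
theorem isIso_of_isIso {A' B' Z' : C} {x' : A' ⟶ B'} {y' : B' ⟶ Z'} {δ' : Extn E Z' A'}
    (h : s.Real x y δ) (h' : s.Real x' y' δ') (a : A ≅ A') (c : Z ≅ Z')
    (hac : push E a.hom Z δ = pull E c.hom A' δ') (b : B ⟶ B')
    (hx : x ≫ b = a.hom ≫ x') (hy : y ≫ c.hom = b ≫ y') : IsIso b := by
  obtain ⟨b', hx', hy'⟩ := s.real_lift h' h a.inv c.inv (by
    have e : δ' = pull E c.inv A' (push E a.hom Z δ) := by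
      rw [hac, ← pull_comp, c.inv_hom_id, pull_id]
    rw [e, ← pull_push, ← push_comp, a.hom_inv_id, push_id])
  have i1 : IsIso (b ≫ b') := isIso_of_endo h _
    (by rw [← Category.assoc, hx, Category.assoc, hx', a.hom_inv_id_assoc])
    (by rw [Category.assoc, ← hy', ← Category.assoc, ← hy, Category.assoc, c.hom_inv_id,
      Category.comp_id])
  have i2 : IsIso (b' ≫ b) := isIso_of_endo h' _
    (by rw [← Category.assoc, hx', Category.assoc, hx, a.inv_hom_id_assoc])
    (by rw [Category.assoc, ← hy, ← Category.assoc, ← hy', Category.assoc, c.inv_hom_id,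
      Category.comp_id])
  have hr : (inv (b' ≫ b) ≫ b') ≫ b = 𝟙 _ := by rw [Category.assoc, IsIso.inv_hom_id]
  have hl : b ≫ (b' ≫ inv (b ≫ b')) = 𝟙 _ := by rw [← Category.assoc, IsIso.hom_inv_id]
  have heq : inv (b' ≫ b) ≫ b' = b' ≫ inv (b ≫ b') := by
    rw [← Category.comp_id (inv (b' ≫ b) ≫ b'), ← hl, ← Category.assoc, hr, Category.id_comp]
  exact ⟨b' ≫ inv (b ≫ b'), hl, by rw [← heq, hr]⟩

/-- `𝔼`-triangles are stable under isomorphisms of their ends. -/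
theorem real_of_iso_ends (h : s.Real x y δ) {A' Z' : C} (a : A ≅ A') (c : Z ≅ Z') :
    s.Real (a.inv ≫ x) (y ≫ c.hom) (pull E c.inv A' (push E a.hom Z δ)) := by
  obtain ⟨B', x', y', h'⟩ := s.exists_real (pull E c.inv A' (push E a.hom Z δ))
  have hac : push E a.hom Z δ = pull E c.hom A' (pull E c.inv A' (push E a.hom Z δ)) := by
    rw [← pull_comp, c.hom_inv_id, pull_id]
  obtain ⟨b, hx, hy⟩ := s.real_lift h h' a.hom c.hom hac
  have : IsIso b := isIso_of_isIso h h' a c hac b hx hy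
  have := s.real_of_iso (asIso b).symm h'
  convert this using 1
  · simp only [Iso.symm_hom, asIso_inv, IsIso.eq_comp_inv]
    rw [Category.assoc, hx, a.inv_hom_id_assoc]
  · simpa using hy

theorem tri_congr {A A' B B' Z Z' : C} (h : s.Tri A B Z) (a : A ≅ A') (b : B ≅ B')
    (c : Z ≅ Z') : s.Tri A' B' Z' := by
  obtain ⟨x, y, δ, h⟩ := h
  exact ⟨_, _, _, s.real_of_iso b (real_of_iso_ends h a c)⟩

theorem tri_biprod (s : Extriangulation E) (A Z : C) : s.Tri A (A ⊞ Z) Z :=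
  ⟨_, _, _, s.real_zero A Z⟩

/-- A split `𝔼`-triangle has a biproduct in the middle. -/
theorem nonempty_iso_biprod (h : s.Real x y (0 : Extn E Z A)) : Nonempty (B ≅ A ⊞ Z) := by
  obtain ⟨e, -, -⟩ := s.real_unique h (s.real_zero A Z)
  exact ⟨e⟩

/-- The isomorphism `O ⊞ Z ≅ Z` for a zero object `O`. -/
noncomputable def biprodIsoOfIsZero {O : C} (hO : IsZero O) (Z : C) : O ⊞ Z ≅ Z where
  hom := biprod.snd
  inv := biprod.inr
  hom_inv_id := by
    ext
    · exact hO.eq_of_src _ _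
    · exact hO.eq_of_src _ _
    · exact hO.eq_of_tgt _ _
    · simp

theorem real_zero_left (s : Extriangulation E) {O : C} (hO : IsZero O) (Z : C) :
    s.Real (0 : O ⟶ Z) (𝟙 Z) (0 : Extn E Z O) := by
  have := s.real_of_iso (biprodIsoOfIsZero hO Z) (s.real_zero O Z)
  rwa [hO.eq_of_src (_ ≫ _) 0, show (biprodIsoOfIsZero hO Z).inv ≫ biprod.snd = 𝟙 Z from
    (biprodIsoOfIsZero hO Z).inv_hom_id] at this

theorem tri_zero_left (s : Extriangulation E) {O : C} (hO : IsZero O) (Z : C) : s.Tri O Z Z :=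
  ⟨_, _, _, s.real_zero_left hO Z⟩

/-- The pull-back square of two deflations with the same target. -/
theorem exists_pullback {A₁ A₂ B₁ B₂ Z : C} (h₁ : s.Tri A₁ B₁ Z) (h₂ : s.Tri A₂ B₂ Z) :
    ∃ M : C, s.Tri A₁ M B₂ ∧ s.Tri A₂ M B₁ := by
  obtain ⟨x₁, y₁, δ₁, h₁⟩ := h₁
  obtain ⟨x₂, y₂, δ₂, h₂⟩ := h₂
  obtain ⟨M, i, p, hM⟩ := s.exists_real (pull E y₂ A₁ δ₁)
  refine ⟨M, ⟨_, _, _, hM⟩, ?_⟩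
  obtain ⟨K, d, e, k, ε, hk, -, -, hK, hε₂, hε₁⟩ := s.et4_op hM h₂
  have h0 : pull E x₂ A₁ (pull E y₂ A₁ δ₁) = 0 := by
    rw [← pull_comp, comp_eq_zero h₂, s.pull_zero]
  rw [h0] at hK
  obtain ⟨r, hr⟩ := exists_inflation_comp_eq hK (𝟙 A₁) (by rw [map_zero])
  -- The retraction `r` of `d` satisfies `r_* ε = δ₁` only after pulling back along `y₂`. The error
  -- is `t_* δ₂ = (e ≫ t)_* ε`, so `r - e ≫ t` is a retraction carrying `ε` exactly to `δ₁`.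
  obtain ⟨t, ht⟩ := exists_push_eq h₂ (push E r Z ε - δ₁) (by
    rw [map_sub, pull_push, ← hε₁, ← push_comp, hr, push_id, sub_self])
  have hde : d ≫ e = 0 := comp_eq_zero hK
  have hr' : d ≫ (r - e ≫ t) = 𝟙 A₁ := by
    rw [Preadditive.comp_sub, hr, ← Category.assoc, hde, zero_comp, sub_zero]
  have hδ : push E (r - e ≫ t) Z ε = δ₁ := by
    rw [s.push_sub, push_comp, hε₂, ht, sub_sub_cancel]
  generalize r - e ≫ t = q at hr' hδ
  obtain ⟨j, hj⟩ := exists_comp_deflation_eq hK (𝟙 A₂) (by rw [map_zero])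
  have hs : ∃ j' : A₂ ⟶ K, j' ≫ e = 𝟙 A₂ ∧ j' ≫ q = 0 := by
    refine ⟨j - j ≫ q ≫ d, ?_, ?_⟩
    · simp [hj, hde]
    · simp [hr']
  obtain ⟨j', hje, hjq⟩ := hs
  have hsum : e ≫ j' + q ≫ d = 𝟙 K := by
    obtain ⟨m, hm⟩ := exists_deflation_comp_eq hK (𝟙 K - (e ≫ j' + q ≫ d)) (by
      simp [reassoc_of% hde, reassoc_of% hr'])
    have hm0 : m = 0 := by
      have := congrArg (fun t => j' ≫ t) hm
      simpa [reassoc_of% hje, reassoc_of% hjq] using this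
    rw [hm0, comp_zero] at hm
    exact (sub_eq_zero.mp hm.symm).symm
  have hsplit := s.real_of_iso (⟨biprod.desc j' d, biprod.lift e q,
    by ext <;> simp [hje, hjq, hde, hr'], by simpa using hsum⟩ : A₂ ⊞ A₁ ≅ K)
    (s.real_zero A₂ A₁)
  simp only [biprod.inl_desc, biprod.lift_snd] at hsplit
  -- The cone of `A₂ ⟶ K ⟶ M` is an extension of `Z` by `A₁` with class `q_* ε = δ₁`, hence is `B₁`.
  obtain ⟨L, d', e', k', ε', hL, -, -, hL', -, -⟩ := s.et4 hsplit hk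
  rw [hδ] at hL'
  obtain ⟨u, -, -⟩ := s.real_unique hL' h₁
  exact tri_congr ⟨_, _, _, hL⟩ (Iso.refl _) (Iso.refl _) u

theorem tri_comp_inflation {A B D G H : C} (h : s.Tri A B D) (h' : s.Tri B G H) :
    ∃ K : C, s.Tri A G K ∧ s.Tri D K H := by
  obtain ⟨_, _, _, h⟩ := h
  obtain ⟨_, _, _, h'⟩ := h'
  obtain ⟨K, _, _, _, _, h1, -, -, h2, -, -⟩ := s.et4 h h'
  exact ⟨K, ⟨_, _, _, h1⟩, ⟨_, _, _, h2⟩⟩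

theorem tri_comp_deflation {D A B H G : C} (h : s.Tri D A B) (h' : s.Tri H B G) :
    ∃ K : C, s.Tri K A G ∧ s.Tri D K H := by
  obtain ⟨_, _, _, h⟩ := h
  obtain ⟨_, _, _, h'⟩ := h'
  obtain ⟨K, _, _, _, _, h1, -, -, h2, -, -⟩ := s.et4_op h h'
  exact ⟨K, ⟨_, _, _, h1⟩, ⟨_, _, _, h2⟩⟩

/-- If `𝔼(N, M) = 0`, a deflation `W ⟶ M` and an inflation `W ⟶ T` with cone `N` yield a deflation
`T ⟶ M`. -/
theorem exists_tri_of_extn_subsingleton {A W M T N : C} (h : s.Tri A W M) (h' : s.Tri W T N)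
    (h0 : Subsingleton (Extn E N M)) : ∃ L : C, s.Tri L T M ∧ s.Tri A L N := by
  -- The object `K` plays the pushout of `M ⟵ W ⟶ T`. Since `M ⟶ K ⟶ N` splits, its ends can be
  -- exchanged, and `T ⟶ K ⟶ M` is a composite of deflations.
  obtain ⟨K, h1, x, y, δ, h2⟩ := tri_comp_inflation h h'
  rw [Subsingleton.elim δ 0] at h2
  obtain ⟨e⟩ := nonempty_iso_biprod h2
  have h3 : s.Tri N K M := tri_congr (s.tri_biprod N M) (Iso.refl _)
    (biprod.braiding _ _ ≪≫ e.symm) (Iso.refl _)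
  exact tri_comp_deflation h1 h3

/-- A row `(f, y)` with `y` a deflation is a deflation. -/
theorem exists_real_desc (h : s.Real x y δ) {Y : C} (f : Y ⟶ Z) :
    ∃ (K : C) (k : K ⟶ Y ⊞ B) (ε : Extn E Z K),
      s.Real k (biprod.desc f y) ε ∧ s.Tri A K Y := by
  obtain ⟨O, hO⟩ := HasZeroObject.zero (C := C)
  have hs := s.real_sum (s.real_zero_left hO Y) h
  -- A shear of `Y ⊞ Z` writes `(f, y)` as the deflation `1 ⊕ y` followed by a split deflation onto
  -- `Z`.
  let e : Y ⊞ Z ≅ Y ⊞ Z := ⟨biprod.lift biprod.fst (biprod.snd - biprod.fst ≫ f),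
    biprod.lift biprod.fst (biprod.snd + biprod.fst ≫ f), by ext <;> simp, by ext <;> simp⟩
  have h2 := s.real_of_iso e (s.real_zero Y Z)
  obtain ⟨K, d, e', k, ε, hk, -, -, hd, -, -⟩ := s.et4_op hs h2
  have hcomp : biprod.map (𝟙 Y) y ≫ e.inv ≫ biprod.snd = biprod.desc f y := by
    ext <;> simp [e]
  rw [hcomp] at hk
  exact ⟨K, k, ε, hk, tri_congr ⟨_, _, _, hd⟩ (biprodIsoOfIsZero hO A) (Iso.refl _) (Iso.refl _)⟩

end Extriangulation
end ExtriangulationLemmas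
-- Tensors in the coend, induced maps and connecting maps.
section Coend

variable {C : Type u} [Category.{v} C] {E : Cᵒᵖ ⥤ C ⥤ AddCommGrpCat.{w}}
  {F G H : Cᵒᵖ ⥤ AddCommGrpCat.{max u w}}

/-- The element `x ⊗ δ` of `(F ⋄ 𝔼)(Z)`. -/
def tmul {Z X : C} (x : F.obj (op X)) (δ : Extn E Z X) : CoendObj E F Z :=
  QuotientAddGroup.mk (FreeAbelianGroup.of ⟨X, x, δ⟩)

theorem mk_eq_zero_of_rel {Z : C} {r : FreeAbelianGroup (CoendGen E F Z)}
    (hr : CoendRel E F Z r) : (QuotientAddGroup.mk r : CoendObj E F Z) = 0 :=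
  (QuotientAddGroup.eq_zero_iff r).mpr (AddSubgroup.subset_closure hr)

theorem add_tmul {Z X : C} (x x' : F.obj (op X)) (δ : Extn E Z X) :
    tmul (x + x') δ = tmul x δ + tmul x' δ := by
  have := mk_eq_zero_of_rel (CoendRel.add_left (E := E) X x x' δ)
  rw [QuotientAddGroup.mk_sub, QuotientAddGroup.mk_sub, sub_sub, sub_eq_zero] at this
  exact this

theorem tmul_add {Z X : C} (x : F.obj (op X)) (δ δ' : Extn E Z X) :
    tmul x (δ + δ') = tmul x δ + tmul x δ' := by
  have := mk_eq_zero_of_rel (CoendRel.add_right (E := E) X x δ δ')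
  rw [QuotientAddGroup.mk_sub, QuotientAddGroup.mk_sub, sub_sub, sub_eq_zero] at this
  exact this

theorem map_tmul {Z X Y : C} (f : X ⟶ Y) (x : F.obj (op Y)) (δ : Extn E Z X) :
    tmul ((F.map f.op).hom x) δ = tmul x (push E f Z δ) := by
  have := mk_eq_zero_of_rel (CoendRel.balanced (E := E) f x δ)
  rw [QuotientAddGroup.mk_sub, sub_eq_zero] at this
  exact this

theorem zero_tmul {Z X : C} (δ : Extn E Z X) : tmul (0 : F.obj (op X)) δ = 0 := by
  simpa using add_tmul (0 : F.obj (op X)) 0 δ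

theorem tmul_zero {Z X : C} (x : F.obj (op X)) : tmul x (0 : Extn E Z X) = 0 := by
  simpa using tmul_add x (0 : Extn E Z X) 0

theorem neg_tmul {Z X : C} (x : F.obj (op X)) (δ : Extn E Z X) : tmul (-x) δ = - tmul x δ := by
  rw [eq_neg_iff_add_eq_zero, ← add_tmul, neg_add_cancel, zero_tmul]

theorem coendFunctor_map_tmul {Z Z' X : C} (c : Z' ⟶ Z) (x : F.obj (op X)) (δ : Extn E Z X) :
    ((coendFunctor E F).map c.op).hom (tmul x δ) = tmul x (pull E c X δ) := by
  change QuotientAddGroup.mk (coendGenMap E F c (FreeAbelianGroup.of ⟨X, x, δ⟩)) = _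
  rw [coendGenMap_of]
  rfl

theorem coend_addHom_ext {Z : C} {M : Type*} [AddCommGroup M] {f g : CoendObj E F Z →+ M}
    (h : ∀ (X : C) (x : F.obj (op X)) (δ : Extn E Z X), f (tmul x δ) = g (tmul x δ)) : f = g := by
  refine QuotientAddGroup.addMonoidHom_ext _ (FreeAbelianGroup.lift_ext _ _ ?_)
  rintro ⟨X, x, δ⟩
  exact h X x δ

/-- The map `x ⊗ δ ↦ φ(x) ⊗ δ` at an object. -/
def coendTransApp (φ : F ⟶ G) (Z : C) : CoendObj E F Z →+ CoendObj E G Z :=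
  QuotientAddGroup.lift _ (FreeAbelianGroup.lift fun g : CoendGen E F Z =>
    (tmul ((φ.app (op g.1)).hom g.2.1) g.2.2 : CoendObj E G Z)) (by
    intro r hr
    have : coendRelSubgroup E F Z ≤ (FreeAbelianGroup.lift fun g : CoendGen E F Z =>
        (tmul ((φ.app (op g.1)).hom g.2.1) g.2.2 : CoendObj E G Z)).ker := by
      rw [coendRelSubgroup, AddSubgroup.closure_le]
      intro r hr
      rw [SetLike.mem_coe, AddMonoidHom.mem_ker]
      cases hr with
      | add_left X x x' δ =>
        simp only [map_sub, FreeAbelianGroup.lift_apply_of, map_add, add_tmul]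
        abel
      | add_right X x δ δ' =>
        simp only [map_sub, FreeAbelianGroup.lift_apply_of, tmul_add]
        abel
      | balanced f x δ =>
        simp only [map_sub, FreeAbelianGroup.lift_apply_of]
        rw [← map_tmul, sub_eq_zero]
        congr 1
        exact ConcreteCategory.congr_hom (φ.naturality f.op) x
    exact this hr)

theorem coendTransApp_tmul (φ : F ⟶ G) {Z X : C} (x : F.obj (op X)) (δ : Extn E Z X) :
    coendTransApp φ Z (tmul x δ) = tmul ((φ.app (op X)).hom x) δ := by
  change FreeAbelianGroup.lift _ (FreeAbelianGroup.of _) = _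
  rw [FreeAbelianGroup.lift_apply_of]

/-- The natural transformation `φ ⋄ 𝔼 : F ⋄ 𝔼 ⟶ G ⋄ 𝔼`. -/
def coendTrans (φ : F ⟶ G) : coendFunctor E F ⟶ coendFunctor E G where
  app Z := AddCommGrpCat.ofHom (coendTransApp φ Z.unop)
  naturality Z Z' c := by
    refine AddCommGrpCat.hom_ext (coend_addHom_ext fun X x δ => ?_)
    change coendTransApp φ Z'.unop (((coendFunctor E F).map c.unop.op).hom (tmul x δ)) =
      ((coendFunctor E G).map c.unop.op).hom (coendTransApp φ Z.unop (tmul x δ))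
    rw [coendFunctor_map_tmul, coendTransApp_tmul, coendTransApp_tmul, coendFunctor_map_tmul]

theorem coendTrans_app_tmul (φ : F ⟶ G) {Z X : C} (x : F.obj (op X)) (δ : Extn E Z X) :
    ((coendTrans (E := E) φ).app (op Z)).hom (tmul x δ) = tmul ((φ.app (op X)).hom x) δ :=
  coendTransApp_tmul φ x δ

/-- The natural map `𝔼^i(-, A) ⟶ 𝔼^i(-, A')` induced by `a : A ⟶ A'`. -/
def posExtMap (E : Cᵒᵖ ⥤ C ⥤ AddCommGrpCat.{w}) {A A' : C} (a : A ⟶ A') :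
    ∀ i : ℕ, posExt E A i ⟶ posExt E A' i
  | 0 => Functor.whiskerRight (E.flip.map a) _
  | i + 1 => coendTrans (posExtMap E a i)

/-- The connecting map `𝔼(-, Z) ⟶ 𝔼²(-, A)`, `ε ↦ δ ⊗ ε`. -/
def firstConnecting {A Z : C} (δ : Extn E Z A) : posExt E Z 0 ⟶ posExt E A 1 where
  app Y := AddCommGrpCat.ofHom
    (AddMonoidHom.mk' (fun ε => tmul (F := posExt E A 0) (ULift.up δ) (ULift.down ε))
      fun ε ε' => tmul_add _ _ _)
  naturality Y Y' c := by
    ext ε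
    exact (coendFunctor_map_tmul c.unop _ _).symm

/-- The connecting map `𝔼^i(-, Z) ⟶ 𝔼^{i+1}(-, A)`. -/
def connecting {A Z : C} (δ : Extn E Z A) : ∀ i : ℕ, posExt E Z i ⟶ posExt E A (i + 1)
  | 0 => firstConnecting δ
  | i + 1 => coendTrans (connecting δ i)

/-- Exactness of `F ⟶ G ⟶ H` at `G`, one inclusion. -/
def KerLeRange (φ : F ⟶ G) (ψ : G ⟶ H) : Prop :=
  ∀ (Z : C) (y : G.obj (op Z)), (ψ.app (op Z)).hom y = 0 → ∃ x, (φ.app (op Z)).hom x = y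

theorem KerLeRange.subsingleton {φ : F ⟶ G} {ψ : G ⟶ H} (h : KerLeRange φ ψ) (Z : C)
    (hF : Subsingleton (F.obj (op Z))) (hH : Subsingleton (H.obj (op Z))) :
    Subsingleton (G.obj (op Z)) := by
  refine subsingleton_of_forall_eq 0 fun y => ?_
  obtain ⟨x, rfl⟩ := h Z y (Subsingleton.elim _ _)
  rw [Subsingleton.elim x 0, map_zero]

end Coend

/-! ### Effaceable functors and the vanishing of tensors. -/

section Effaceable

variable {C : Type u} [Category.{v} C] [Preadditive C] [HasZeroObject C] [HasBinaryBiproducts C]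
  {E : Cᵒᵖ ⥤ C ⥤ AddCommGrpCat.{w}} {F G H : Cᵒᵖ ⥤ AddCommGrpCat.{max u w}}

/-- Every element of `(F ⋄ 𝔼)(Z)` is a single tensor. -/
theorem exists_tmul (s : Extriangulation E) {Z : C} (t : CoendObj E F Z) :
    ∃ (X : C) (x : F.obj (op X)) (δ : Extn E Z X), tmul x δ = t := by
  obtain ⟨r, rfl⟩ := QuotientAddGroup.mk_surjective t
  induction r using FreeAbelianGroup.induction_on with
  | zero => exact ⟨Z, 0, 0, zero_tmul _⟩
  | of g => exact ⟨g.1, g.2.1, g.2.2, rfl⟩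
  | neg g h =>
    obtain ⟨X, x, δ, h⟩ := h
    exact ⟨X, -x, δ, by rw [neg_tmul, h]; rfl⟩
  | add a b ha hb =>
    obtain ⟨X, x, δ, ha⟩ := ha
    obtain ⟨X', x', δ', hb⟩ := hb
    -- Over `X ⊞ X'` the cross terms die by balancing, since the mixed components of the injections
    -- and projections vanish.
    refine ⟨X ⊞ X', (F.map (biprod.fst : X ⊞ X' ⟶ X).op).hom x +
      (F.map (biprod.snd : X ⊞ X' ⟶ X').op).hom x',
      push E biprod.inl Z δ + push E biprod.inr Z δ', ?_⟩
    rw [add_tmul, map_tmul, map_tmul, map_add, map_add, ← push_comp, ← push_comp, ← push_comp,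
      ← push_comp, biprod.inl_fst, biprod.inr_fst, biprod.inl_snd, biprod.inr_snd, push_id, push_id,
      s.push_zero, s.push_zero, add_zero, zero_add, ha, hb]
    rfl

/-- An additive contravariant functor each of whose elements is killed by some deflation. -/
structure IsEffaceable (s : Extriangulation E) (F : Cᵒᵖ ⥤ AddCommGrpCat.{max u w}) : Prop where
  map_add : ∀ {X Y : C} (f g : X ⟶ Y) (x : F.obj (op Y)),
    (F.map (f + g).op).hom x = (F.map f.op).hom x + (F.map g.op).hom x
  efface : ∀ {W : C} (x : F.obj (op W)), ∃ (K V : C) (i : K ⟶ V) (p : V ⟶ W) (ε : Extn E W K),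
    s.Real i p ε ∧ (F.map p.op).hom x = 0

theorem IsEffaceable.posExt_zero (s : Extriangulation E) (A : C) :
    IsEffaceable s (posExt E A 0) where
  map_add f g x := ULift.ext _ _ (s.pull_add f g (ULift.down x))
  efface {W} x := by
    obtain ⟨V, i, p, h⟩ := s.exists_real (ULift.down x : Extn E W A)
    exact ⟨A, V, i, p, _, h, ULift.ext _ _ (Extriangulation.pull_deflation h)⟩

/-- Since every element is a single tensor `x ⊗ δ`, additivity reduces to that of `𝔼`, and the
deflation realizing `δ` kills the element. -/
theorem IsEffaceable.coend (s : Extriangulation E) (F : Cᵒᵖ ⥤ AddCommGrpCat.{max u w}) :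
    IsEffaceable s (coendFunctor E F) where
  map_add f g x := by
    obtain ⟨X, x, δ, rfl⟩ := exists_tmul s x
    simp only [coendFunctor_map_tmul, s.pull_add, tmul_add]
    rfl
  efface {W} x := by
    obtain ⟨X, x, δ, rfl⟩ := exists_tmul s x
    obtain ⟨V, i, p, h⟩ := s.exists_real δ
    refine ⟨X, V, i, p, _, h, ?_⟩
    rw [coendFunctor_map_tmul, Extriangulation.pull_deflation h, tmul_zero]
    rfl

theorem IsEffaceable.posExt (s : Extriangulation E) (A : C) (i : ℕ) :
    IsEffaceable s (posExt E A i) := by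
  cases i with
  | zero => exact posExt_zero s A
  | succ i => exact coend s _

/-- `x` becomes zero after replacing the extension `ε ∈ 𝔼(Z, V)` by one that maps to it. -/
def RefinesToZero (F : Cᵒᵖ ⥤ AddCommGrpCat.{max u w}) {Z V : C} (ε : Extn E Z V)
    (x : F.obj (op V)) : Prop :=
  ∃ (V' : C) (w : V' ⟶ V) (ε' : Extn E Z V'), push E w Z ε' = ε ∧ (F.map w.op).hom x = 0

theorem map_comp_apply {X Y Z : C} (f : X ⟶ Y) (g : Y ⟶ Z) (x : F.obj (op Z)) :
    (F.map (f ≫ g).op).hom x = (F.map f.op).hom ((F.map g.op).hom x) := by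
  simp

theorem IsEffaceable.map_sub {s : Extriangulation E} (hF : IsEffaceable s F) {X Y : C}
    (f g : X ⟶ Y) (x : F.obj (op Y)) :
    (F.map (f - g).op).hom x = (F.map f.op).hom x - (F.map g.op).hom x := by
  rw [eq_sub_iff_add_eq, ← hF.map_add, sub_add_cancel]

/-- As `h_* ε = 0`, `h` extends to `c` on the middle term `B` of `ε`. A deflation `q` onto `B`
effaces `c^* x`, and the dual of (ET4) lifts `ε` to the kernel of `q ≫ p`, whose map to `B` factors
through `q`. -/
theorem RefinesToZero.map_of_push_eq_zero {s : Extriangulation E} (hF : IsEffaceable s F)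
    {Z V W : C} (ε : Extn E Z V) (h : V ⟶ W) (hε : push E h Z ε = 0) (x : F.obj (op W)) :
    RefinesToZero F ε ((F.map h.op).hom x) := by
  obtain ⟨B, i, p, hB⟩ := s.exists_real ε
  obtain ⟨c, rfl⟩ := Extriangulation.exists_inflation_comp_eq hB h hε
  obtain ⟨K, V', j, q, ζ, hq, hx⟩ := hF.efface ((F.map c.op).hom x)
  obtain ⟨N, d, e, k, ε', -, -, hke, -, hε', -⟩ := s.et4_op hq hB
  refine ⟨N, e, ε', hε', ?_⟩
  rw [← map_comp_apply, ← Category.assoc, ← hke, Category.assoc, map_comp_apply,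
    map_comp_apply, hx, _root_.map_zero]

theorem RefinesToZero.map_sub_map {s : Extriangulation E} (hF : IsEffaceable s F)
    {Z V W : C} (ε : Extn E Z V) (a b : V ⟶ W) (h : push E a Z ε = push E b Z ε)
    (x : F.obj (op W)) :
    RefinesToZero F ε ((F.map a.op).hom x - (F.map b.op).hom x) := by
  rw [← hF.map_sub]
  exact map_of_push_eq_zero hF ε _ (by rw [s.push_sub, h, sub_self]) x

theorem RefinesToZero.neg {Z V : C} {ε : Extn E Z V} {x : F.obj (op V)}
    (h : RefinesToZero F ε x) : RefinesToZero F ε (-x) := by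
  obtain ⟨V', w, ε', hε, hx⟩ := h
  exact ⟨V', w, ε', hε, by rw [_root_.map_neg, hx, neg_zero]⟩

theorem RefinesToZero.zero {Z V : C} (ε : Extn E Z V) : RefinesToZero F ε 0 :=
  ⟨V, 𝟙 V, ε, push_id E _ _ _, _root_.map_zero _⟩

theorem push_lift_fst (s : Extriangulation E) {Z V W : C} (ε : Extn E Z V) (ε' : Extn E Z W) :
    push E biprod.fst Z (push E (biprod.inl : V ⟶ V ⊞ W) Z ε +
      push E (biprod.inr : W ⟶ V ⊞ W) Z ε') = ε := by
  rw [_root_.map_add, ← push_comp, ← push_comp, biprod.inl_fst, biprod.inr_fst, push_id,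
    s.push_zero, add_zero]

theorem push_lift_snd (s : Extriangulation E) {Z V W : C} (ε : Extn E Z V) (ε' : Extn E Z W) :
    push E biprod.snd Z (push E (biprod.inl : V ⟶ V ⊞ W) Z ε +
      push E (biprod.inr : W ⟶ V ⊞ W) Z ε') = ε' := by
  rw [_root_.map_add, ← push_comp, ← push_comp, biprod.inl_snd, biprod.inr_snd, push_id,
    s.push_zero, zero_add]

theorem RefinesToZero.add {s : Extriangulation E} (hF : IsEffaceable s F) {Z V : C}
    {ε : Extn E Z V} {x y : F.obj (op V)} (hx : RefinesToZero F ε x) (hy : RefinesToZero F ε y) :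
    RefinesToZero F ε (x + y) := by
  obtain ⟨V₁, w₁, ε₁, h₁, hx⟩ := hx
  obtain ⟨V₂, w₂, ε₂, h₂, hy⟩ := hy
  -- The two maps `V₁ ⊞ V₂ ⟶ V` need not agree, but they push the combined extension to the same
  -- `ε`; one further refinement equalizes their effect on `y`.
  obtain ⟨V', v, ε', hv, hz⟩ := map_sub_map hF
    (push E (biprod.inl : V₁ ⟶ V₁ ⊞ V₂) Z ε₁ + push E (biprod.inr : V₂ ⟶ V₁ ⊞ V₂) Z ε₂)
    (biprod.fst ≫ w₁) (biprod.snd ≫ w₂)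
    (by rw [push_comp, push_comp, push_lift_fst s, push_lift_snd s, h₁, h₂]) y
  rw [map_comp_apply biprod.snd, hy, _root_.map_zero, sub_zero] at hz
  refine ⟨V', v ≫ biprod.fst ≫ w₁, ε', ?_, ?_⟩
  · rw [push_comp, hv, push_comp, push_lift_fst s, h₁]
  · rw [map_comp_apply, _root_.map_add, _root_.map_add, hz, add_zero, map_comp_apply, hx,
      _root_.map_zero, _root_.map_zero]

/-- The pairs `(∑ nᵢ [Xᵢ, xᵢ, δᵢ], ∑ nᵢ uᵢ^* xᵢ)` with `uᵢ : V ⟶ Xᵢ` such that `(uᵢ)_* ε = δᵢ`. -/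
def representatives (F : Cᵒᵖ ⥤ AddCommGrpCat.{max u w}) {Z V : C} (ε : Extn E Z V) :
    AddSubgroup (FreeAbelianGroup (CoendGen E F Z) × F.obj (op V)) :=
  AddSubgroup.closure {q | ∃ (X : C) (x : F.obj (op X)) (f : V ⟶ X),
    q = (FreeAbelianGroup.of ⟨X, x, push E f Z ε⟩, (F.map f.op).hom x)}

theorem of_mem_representatives {Z V X : C} (ε : Extn E Z V) (x : F.obj (op X)) (f : V ⟶ X)
    {δ : Extn E Z X} (h : push E f Z ε = δ) :
    (FreeAbelianGroup.of ⟨X, x, δ⟩, (F.map f.op).hom x) ∈ representatives F ε :=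
  AddSubgroup.subset_closure ⟨X, x, f, by rw [h]⟩

theorem representatives_map {Z V W : C} (ε : Extn E Z V) (ζ : Extn E Z W) (f : W ⟶ V)
    (h : push E f Z ζ = ε) {r : FreeAbelianGroup (CoendGen E F Z)} {y : F.obj (op V)}
    (hr : (r, y) ∈ representatives F ε) : (r, (F.map f.op).hom y) ∈ representatives F ζ := by
  have : representatives F ε ≤ (representatives F ζ).comap
      ((AddMonoidHom.id _).prodMap (F.map f.op).hom) := by
    rw [representatives, AddSubgroup.closure_le]
    rintro _ ⟨X, x, g, rfl⟩
    change (_, (F.map f.op).hom ((F.map g.op).hom x)) ∈ representatives F ζ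
    rw [← map_comp_apply]
    exact of_mem_representatives ζ x (f ≫ g) (by rw [push_comp, h])
  exact this hr

/-- Each defining relation evaluates to `0` once its extensions are all pushed from one `ε`; sums
are handled by passing to a biproduct. In `add_right`, additivity of `F` on `fst + snd` is what is
needed. -/
theorem exists_zero_mem_representatives (s : Extriangulation E) (hF : IsEffaceable s F) {Z : C}
    {r : FreeAbelianGroup (CoendGen E F Z)} (hr : r ∈ coendRelSubgroup E F Z) :
    ∃ (V : C) (ε : Extn E Z V), (r, 0) ∈ representatives F ε := by
  induction hr using AddSubgroup.closure_induction with
  | mem r hr =>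
    cases hr with
    | add_left X x x' δ =>
      refine ⟨X, δ, ?_⟩
      have h (x : F.obj (op X)) := of_mem_representatives δ x (𝟙 X) (push_id E _ _ _)
      convert sub_mem (sub_mem (h (x + x')) (h x)) (h x') using 1
      ext <;> simp
    | add_right X x δ δ' =>
      let ζ := push E (biprod.inl : X ⟶ X ⊞ X) Z δ + push E (biprod.inr : X ⟶ X ⊞ X) Z δ'
      refine ⟨X ⊞ X, ζ, ?_⟩
      have h1 := of_mem_representatives ζ x biprod.fst (push_lift_fst s δ δ')
      have h2 := of_mem_representatives ζ x biprod.snd (push_lift_snd s δ δ')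
      have h3 := of_mem_representatives ζ x (biprod.fst + biprod.snd)
        (by rw [s.push_add, push_lift_fst s δ δ', push_lift_snd s δ δ'])
      convert sub_mem (sub_mem h3 h1) h2 using 1
      ext
      · simp
      · simp only [Prod.snd_sub, hF.map_add]
        abel
    | @balanced X Y f x δ =>
      refine ⟨X, δ, ?_⟩
      have h1 := of_mem_representatives δ ((F.map f.op).hom x) (𝟙 X) (push_id E _ _ _)
      have h2 := of_mem_representatives δ x f rfl
      convert sub_mem h1 h2 using 1
      ext <;> simp
  | zero => exact ⟨Z, 0, zero_mem _⟩
  | add r r' _ _ h h' =>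
    obtain ⟨V, ε, h⟩ := h
    obtain ⟨V', ε', h'⟩ := h'
    refine ⟨V ⊞ V', push E biprod.inl Z ε + push E biprod.inr Z ε', ?_⟩
    have h1 := representatives_map _ _ biprod.fst (push_lift_fst s ε ε') h
    have h2 := representatives_map _ _ biprod.snd (push_lift_snd s ε ε') h'
    rw [_root_.map_zero] at h1 h2
    simpa using add_mem h1 h2
  | neg r _ h =>
    obtain ⟨V, ε, h⟩ := h
    exact ⟨V, ε, by simpa using neg_mem h⟩

open Classical in
/-- A choice of value `u^* x` for each generator `[X, x, u_* ε]`. -/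
noncomputable def chosenValue (F : Cᵒᵖ ⥤ AddCommGrpCat.{max u w}) {Z V : C} (ε : Extn E Z V) :
    FreeAbelianGroup (CoendGen E F Z) →+ F.obj (op V) :=
  FreeAbelianGroup.lift fun g =>
    if h : ∃ f : V ⟶ g.1, push E f Z ε = g.2.2 then (F.map h.choose.op).hom g.2.1 else 0

theorem exists_chosenValue_of {Z V X : C} (ε : Extn E Z V) (x : F.obj (op X)) {δ : Extn E Z X}
    (f : V ⟶ X) (h : push E f Z ε = δ) : ∃ f' : V ⟶ X, push E f' Z ε = δ ∧
      chosenValue F ε (FreeAbelianGroup.of ⟨X, x, δ⟩) = (F.map f'.op).hom x := by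
  have h' : ∃ f : V ⟶ X, push E f Z ε = δ := ⟨f, h⟩
  refine ⟨h'.choose, h'.choose_spec, ?_⟩
  rw [chosenValue, FreeAbelianGroup.lift_apply_of, dif_pos h']

/-- The value `u^* x` depends on `u`, but two maps with the same push-forward of `ε` give values
whose difference refines to zero. -/
theorem refinesToZero_sub_chosenValue {s : Extriangulation E} (hF : IsEffaceable s F) {Z V : C}
    (ε : Extn E Z V) {q : FreeAbelianGroup (CoendGen E F Z) × F.obj (op V)}
    (hq : q ∈ representatives F ε) : RefinesToZero F ε (q.2 - chosenValue F ε q.1) := by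
  induction hq using AddSubgroup.closure_induction with
  | mem q hq =>
    obtain ⟨X, x, f, rfl⟩ := hq
    obtain ⟨f', hf', h⟩ := exists_chosenValue_of ε x f rfl
    rw [h]
    exact .map_sub_map hF ε f f' hf'.symm x
  | zero => simpa using RefinesToZero.zero ε
  | add q q' _ _ h h' =>
    convert h.add hF h' using 1
    simp only [Prod.fst_add, Prod.snd_add, _root_.map_add]
    abel
  | neg q _ h =>
    convert h.neg using 1
    simp only [Prod.fst_neg, Prod.snd_neg, _root_.map_neg]
    abel

/-- Vanishing of a tensor `x ⊗ δ` with `x` in an effaceable functor. -/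
theorem refinesToZero_of_tmul_eq_zero {s : Extriangulation E} (hF : IsEffaceable s F) {Z W : C}
    {x : F.obj (op W)} {δ : Extn E Z W} (h : tmul x δ = 0) : RefinesToZero F δ x := by
  obtain ⟨V₀, ε₀, h₀⟩ :=
    exists_zero_mem_representatives s hF ((QuotientAddGroup.eq_zero_iff _).mp h)
  -- Adding `W` as a summand ensures that the generator also has a representing map, so its chosen
  -- value is `f^* x`; comparison with the value `0` makes `f^* x` refine to zero.
  have h₁ := representatives_map _ _ biprod.fst (push_lift_fst s ε₀ δ) h₀
  obtain ⟨f, hf, hval⟩ := exists_chosenValue_of _ x biprod.snd (push_lift_snd s ε₀ δ)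
  obtain ⟨V', w, ε', hw, hx⟩ := (refinesToZero_sub_chosenValue hF _ h₁).neg
  refine ⟨V', w ≫ f, ε', by rw [push_comp, hw, hf], ?_⟩
  rw [map_comp_apply]
  simpa [hval] using hx

end Effaceable

/-! ### Long exact sequences for the higher extension functors. -/

section ExactSequences

variable {C : Type u} [Category.{v} C] [Preadditive C] [HasZeroObject C] [HasBinaryBiproducts C]
  {E : Cᵒᵖ ⥤ C ⥤ AddCommGrpCat.{w}} {F G H : Cᵒᵖ ⥤ AddCommGrpCat.{max u w}}

/-- A tensor killed by `ψ` can be rewritten, by refining its extension, with a first factor that `ψ`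
kills; exactness is then applied to that factor alone. -/
theorem KerLeRange.coendTrans {s : Extriangulation E} (hH : IsEffaceable s H) {φ : F ⟶ G}
    {ψ : G ⟶ H} (h : KerLeRange φ ψ) :
    KerLeRange (coendTrans (E := E) φ) (coendTrans (E := E) ψ) := by
  intro Z y hy
  obtain ⟨X, y, δ, rfl⟩ := exists_tmul s y
  rw [coendTrans_app_tmul] at hy
  obtain ⟨V, f, ε, rfl, hf⟩ := refinesToZero_of_tmul_eq_zero hH hy
  obtain ⟨x, hx⟩ := h V ((G.map f.op).hom y) (by
    rw [← hf]
    exact ConcreteCategory.congr_hom (ψ.naturality f.op) y)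
  exact ⟨tmul x ε, by rw [coendTrans_app_tmul, hx, map_tmul]⟩

variable {s : Extriangulation E} {A B Z : C} {x : A ⟶ B} {y : B ⟶ Z} {δ : Extn E Z A}

theorem posExt_exact_middle (h : s.Real x y δ) :
    ∀ i : ℕ, KerLeRange (posExtMap E x i) (posExtMap E y i)
  | 0 => fun Y ε hε => by
    obtain ⟨ε', hε'⟩ := Extriangulation.exists_push_inflation_eq h (ULift.down ε : Extn E Y B)
      (congrArg ULift.down hε)
    exact ⟨ULift.up ε', ULift.ext _ _ hε'⟩
  | i + 1 => (posExt_exact_middle h i).coendTrans (.posExt s Z i)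

theorem posExt_exact_right (h : s.Real x y δ) :
    ∀ i : ℕ, KerLeRange (posExtMap E y i) (connecting δ i)
  | 0 => fun Y ε hε => by
    obtain ⟨V, f, ε', hε', hf⟩ :=
      refinesToZero_of_tmul_eq_zero (.posExt s A 0) (x := ULift.up δ) (δ := ULift.down ε) hε
    -- Vanishing of `δ ⊗ ε` refines `ε` along some `f` with `f^* δ = 0`, and such an `f` factors
    -- through `y`.
    obtain ⟨g, rfl⟩ := Extriangulation.exists_comp_deflation_eq h f (congrArg ULift.down hf)
    exact ⟨ULift.up (push E g Y ε'), ULift.ext _ _ (by rw [← hε', push_comp]; rfl)⟩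
  | i + 1 => (posExt_exact_right h i).coendTrans (.posExt s A (i + 1))

theorem posExt_exact_left (h : s.Real x y δ) :
    ∀ i : ℕ, KerLeRange (connecting δ i) (posExtMap E x (i + 1))
  | 0 => fun Y t ht => by
    obtain ⟨W, a, ε, rfl⟩ := exists_tmul s t
    have ht' : tmul (((posExtMap E x 0).app (op W)).hom a) ε = 0 := by
      rw [← coendTrans_app_tmul]
      exact ht
    obtain ⟨V, f, ε', rfl, hf⟩ := refinesToZero_of_tmul_eq_zero (.posExt s B 0) ht'
    -- After refinement `x_*` kills `f^* a`, so `f^* a = c^* δ`; balancing moves `c` to the other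
    -- factor and exhibits a value of the connecting map.
    obtain ⟨c, hc⟩ := Extriangulation.exists_pull_eq h
      (pull E f A (ULift.down a)) (by
        rw [← pull_push]
        exact congrArg ULift.down hf)
    refine ⟨ULift.up (push E c Y ε'), ?_⟩
    rw [← map_tmul]
    refine (map_tmul (F := posExt E A 0) c (ULift.up δ) ε').symm.trans ?_
    congr 1
    exact ULift.ext _ _ hc
  | i + 1 => (posExt_exact_left h i).coendTrans (.posExt s B (i + 1))

theorem succExtVanishes_middle (h : s.Tri A B Z) {i : ℕ} {Y : C} (hA : SuccExtVanishes E i Y A)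
    (hZ : SuccExtVanishes E i Y Z) : SuccExtVanishes E i Y B := by
  obtain ⟨x, y, δ, h⟩ := h
  exact (posExt_exact_middle h i).subsingleton Y hA hZ

theorem succExtVanishes_right (h : s.Tri A B Z) {i : ℕ} {Y : C} (hB : SuccExtVanishes E i Y B)
    (hA : SuccExtVanishes E (i + 1) Y A) : SuccExtVanishes E i Y Z := by
  obtain ⟨x, y, δ, h⟩ := h
  exact (posExt_exact_right h i).subsingleton Y hB hA

theorem succExtVanishes_left (h : s.Tri A B Z) {i : ℕ} {Y : C} (hZ : SuccExtVanishes E i Y Z)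
    (hB : SuccExtVanishes E (i + 1) Y B) : SuccExtVanishes E (i + 1) Y A := by
  obtain ⟨x, y, δ, h⟩ := h
  exact (posExt_exact_left h i).subsingleton Y hZ hB

theorem succExtVanishes_zero_iff {Y A : C} :
    SuccExtVanishes E 0 Y A ↔ Subsingleton (Extn E Y A) :=
  Equiv.ulift.subsingleton_congr

theorem rightPerp_middle {T : ObjectProperty C} (h : s.Tri A B Z) (hA : rightPerp E T A)
    (hZ : rightPerp E T Z) : rightPerp E T B :=
  fun i Y hY => succExtVanishes_middle h (hA i Y hY) (hZ i Y hY)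

theorem rightPerp_right {T : ObjectProperty C} (h : s.Tri A B Z) (hA : rightPerp E T A)
    (hB : rightPerp E T B) : rightPerp E T Z :=
  fun i Y hY => succExtVanishes_right h (hB i Y hY) (hA (i + 1) Y hY)

end ExactSequences

/-! ### Special precovers, factor classes and tilting classes. -/

section Classes

variable {C : Type u} [Category.{v} C] [Preadditive C] [HasZeroObject C] [HasBinaryBiproducts C]
  {E : Cᵒᵖ ⥤ C ⥤ AddCommGrpCat.{w}} {s : Extriangulation E} {X T : ObjectProperty C}

theorem prop_of_retract (h : X = X.retractClosure) {A B : C} (r : Retract A B) (hB : X B) :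
    X A := by
  rw [h]
  exact ⟨B, hB, ⟨r⟩⟩

theorem prop_of_iso (h : X = X.retractClosure) {A B : C} (e : A ≅ B) (hB : X B) : X A :=
  prop_of_retract h ⟨e.hom, e.inv, e.hom_inv_id⟩ hB

theorem prop_of_isZero (h : X = X.retractClosure) {O B : C} (hO : IsZero O) (hB : X B) : X O :=
  prop_of_retract h ⟨0, 0, hO.eq_of_src _ _⟩ hB

namespace Extriangulation

theorem LeftRes.of_le {Y : ObjectProperty C} : ∀ {m k : ℕ}, m ≤ k → ∀ {B : C},
    s.LeftRes X Y k B → s.LeftRes X Y m B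
  | 0, _, _, _, _ => trivial
  | m + 1, 0, hmk, _, _ => absurd hmk (by omega)
  | m + 1, k + 1, hmk, _, ⟨K, Y₁, h, hY, hK, hr⟩ =>
    ⟨K, Y₁, h, hY, hK, LeftRes.of_le (Nat.le_of_succ_le_succ hmk) hr⟩

theorem LeftRes.mono {Y Y' : ObjectProperty C} (hYY' : Y ≤ Y') : ∀ {m : ℕ} {B : C},
    s.LeftRes X Y m B → s.LeftRes X Y' m B
  | 0, _, _ => trivial
  | _ + 1, _, ⟨K, Y₁, h, hY, hK, hr⟩ => ⟨K, Y₁, h, hYY' _ hY, hK, LeftRes.mono hYY' hr⟩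

theorem fac_of_mem (s : Extriangulation E) (hX : X = X.retractClosure) (hT : T = T.retractClosure)
    {M : C} (hTM : T M) (hXM : X M) : ∀ m : ℕ, s.Fac X T m M
  | 0 => trivial
  | m + 1 => by
    obtain ⟨O, hO⟩ := HasZeroObject.zero (C := C)
    exact ⟨O, M, s.tri_zero_left hO M, ⟨hTM, hXM⟩, prop_of_isZero hX hO hXM,
      fac_of_mem s hX hT (prop_of_isZero hT hO hTM) (prop_of_isZero hX hO hXM) m⟩

/-- `𝒯 ∩ 𝒳` is closed under biproducts when it is contained in `𝒯^⊥`. -/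
theorem biprod_mem (hXext : s.ClosedUnderExtensions X) (hT : T = T.retractClosure)
    (hT5 : T5 E X T) (hTX : T ⊓ X ≤ rightPerp E T) {M N : C} (hM : (T ⊓ X) M)
    (hN : (T ⊓ X) N) : (T ⊓ X) (M ⊞ N) := by
  have hXMN : X (M ⊞ N) := hXext _ _ _ (s.tri_biprod M N) hM.2 hN.2
  -- Both injections lift through a precover of `M ⊞ N`, which makes `M ⊞ N` a retract of an object
  -- of `𝒯`.
  obtain ⟨T', f, ⟨hT', hf⟩, -⟩ := hT5 (M ⊞ N) hXMN
    (rightPerp_middle (s.tri_biprod M N) (hTX M hM) (hTX N hN))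
  obtain ⟨a, ha⟩ := hf M hM.1 biprod.inl
  obtain ⟨b, hb⟩ := hf N hN.1 biprod.inr
  exact ⟨prop_of_retract hT ⟨biprod.desc a b, f, by ext <;> simp [ha, hb]⟩ hT', hXMN⟩

/-- The kernel of a deflation between objects of `𝒯^⊥` belongs to `𝒯^⊥` if all morphisms from `𝒯`
lift along it. -/
theorem rightPerp_of_precover {K T₁ M : C} {k : K ⟶ T₁} {f : T₁ ⟶ M} {δ : Extn E M K}
    (h : s.Real k f δ) (hf : ∀ (Z : C), T Z → ∀ g : Z ⟶ M, ∃ g' : Z ⟶ T₁, g' ≫ f = g)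
    (hT₁ : rightPerp E T T₁) (hM : rightPerp E T M) : rightPerp E T K
  | 0, Z, hZ => by
    rw [succExtVanishes_zero_iff]
    refine subsingleton_of_forall_eq 0 fun ε => ?_
    have := succExtVanishes_zero_iff.mp (hT₁ 0 Z hZ)
    obtain ⟨c, rfl⟩ := exists_pull_eq h ε (Subsingleton.elim _ _)
    obtain ⟨c, rfl⟩ := hf Z hZ c
    rw [pull_comp, pull_deflation h, map_zero]
  | i + 1, Z, hZ => succExtVanishes_left ⟨_, _, _, h⟩ (hM i Z hZ) (hT₁ (i + 1) Z hZ)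

/-- Objects of `𝒯^⊥ ∩ 𝒳` have deflations from `𝒯 ∩ 𝒳` with kernel in `𝒯^⊥ ∩ 𝒳`. -/
theorem exists_special_precover (hXext : s.ClosedUnderExtensions X) (hT : T = T.retractClosure)
    (hT5 : T5 E X T) (hTX : T ⊓ X ≤ rightPerp E T) (hfac : rightPerp E T ⊓ X ≤ s.Fac X T 1)
    {M : C} (hM : (rightPerp E T ⊓ X) M) :
    ∃ K T₁ : C, s.Tri K T₁ M ∧ (T ⊓ X) T₁ ∧ (rightPerp E T ⊓ X) K := by
  obtain ⟨L, T₀, ⟨l, g, δ, h⟩, hT₀, hL, -⟩ := hfac M hM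
  obtain ⟨T', f, ⟨hT', hf⟩, hXT'⟩ := hT5 M hM.2 hM.1
  -- The precover `f` need not be a deflation; adding the deflation `g` makes it one and keeps the
  -- lifting property.
  obtain ⟨K, k, ε, hk, hK⟩ := exists_real_desc h f
  have hmem := biprod_mem hXext hT hT5 hTX ⟨hT', hXT'⟩ hT₀
  refine ⟨K, T' ⊞ T₀, ⟨_, _, _, hk⟩, hmem, ?_, hXext _ _ _ hK hL hXT'⟩
  refine rightPerp_of_precover hk (fun Z hZ g' => ?_) (hTX _ hmem) hM.1
  obtain ⟨q, hq⟩ := hf Z hZ g'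
  exact ⟨q ≫ biprod.inl, by simp [hq]⟩

theorem fac_of_special (hsp : ∀ M : C, (rightPerp E T ⊓ X) M →
      ∃ K T₁ : C, s.Tri K T₁ M ∧ (T ⊓ X) T₁ ∧ (rightPerp E T ⊓ X) K) :
    ∀ (m : ℕ) {M : C}, (rightPerp E T ⊓ X) M → s.Fac X T m M
  | 0, _, _ => trivial
  | m + 1, M, hM => by
    obtain ⟨K, T₁, h, hT₁, hK⟩ := hsp M hM
    exact ⟨K, T₁, h, hT₁, hK.2, fac_of_special hsp m hK⟩

theorem perp_middle (hXext : s.ClosedUnderExtensions X) {A B Z : C} (h : s.Tri A B Z)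
    (hA : (rightPerp E T ⊓ X) A) (hZ : (rightPerp E T ⊓ X) Z) : (rightPerp E T ⊓ X) B :=
  ⟨rightPerp_middle h hA.1 hZ.1, hXext _ _ _ h hA.2 hZ.2⟩

/-- Resolutions by objects of `𝒯^⊥ ∩ 𝒳` can be replaced by resolutions by objects of `𝒯 ∩ 𝒳`. -/
theorem fac_of_leftRes (hXext : s.ClosedUnderExtensions X)
    (hsp : ∀ M : C, (rightPerp E T ⊓ X) M →
      ∃ K T₁ : C, s.Tri K T₁ M ∧ (T ⊓ X) T₁ ∧ (rightPerp E T ⊓ X) K) :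
    ∀ (m : ℕ) {B : C}, s.LeftRes X (rightPerp E T ⊓ X) m B → s.Fac X T m B
  | 0, _, _ => trivial
  | m + 1, B, ⟨K, Y, h, hY, hK, hr⟩ => by
    obtain ⟨L, T₁, hL, hT₁, hLP⟩ := hsp Y hY
    obtain ⟨M, hM, hLM⟩ := tri_comp_deflation hL h
    refine ⟨M, T₁, hM, hT₁, hXext _ _ _ hLM hLP.2 hK, fac_of_leftRes hXext hsp m ?_⟩
    match m, hr with
    | 0, _ => trivial
    | m + 1, ⟨K', Y', h', hY', hK', hr'⟩ =>
      -- Replacing `Y` by `T₁` enlarges the kernel from `K` to `M`. Pulling the next cover back to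
      -- `M` changes its middle term to an extension of `Y'` by `L`, still in `𝒯^⊥ ∩ 𝒳`.
      obtain ⟨N, hN, hN'⟩ := exists_pullback hLM h'
      exact ⟨K', N, hN', perp_middle hXext hN hLP hY', hK', hr'⟩

/-- `𝒯 ∩ 𝒳 ⊆ 𝒯^⊥`, and `𝒯^⊥ ∩ 𝒳` lies between `Fac_n ∩ 𝒳` and `Fac_1`. -/
structure PerpIsFac (s : Extriangulation E) (n : ℕ) (X T : ObjectProperty C) : Prop where
  le_perp : T ⊓ X ≤ rightPerp E T
  perp_le : rightPerp E T ⊓ X ≤ s.Fac X T 1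
  fac_le : s.Fac X T n ⊓ X ≤ rightPerp E T

variable {n : ℕ}

theorem PerpIsFac.special (h : s.PerpIsFac n X T) (hXext : s.ClosedUnderExtensions X)
    (hT : T = T.retractClosure) (hT5 : T5 E X T) (M : C) (hM : (rightPerp E T ⊓ X) M) :
    ∃ K T₁ : C, s.Tri K T₁ M ∧ (T ⊓ X) T₁ ∧ (rightPerp E T ⊓ X) K :=
  exists_special_precover hXext hT hT5 h.le_perp h.perp_le hM

theorem perpIsFac_of_eq (hn : 1 ≤ n) (hX : X = X.retractClosure) (hT : T = T.retractClosure)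
    (h : s.Fac X T n ⊓ X = rightPerp E T ⊓ X) : s.PerpIsFac n X T where
  le_perp M hM := (h.le M ⟨s.fac_of_mem hX hT hM.1 hM.2 n, hM.2⟩).1
  perp_le M hM := (h.ge M hM).1.of_le hn
  fac_le M hM := (h.le M hM).1

theorem PerpIsFac.eq_fac (h : s.PerpIsFac n X T) (hXext : s.ClosedUnderExtensions X)
    (hT : T = T.retractClosure) (hT5 : T5 E X T) {k : ℕ} (hk : n ≤ k) :
    rightPerp E T ⊓ X = s.Fac X T k ⊓ X := by
  apply le_antisymm
  · exact fun M hM => ⟨fac_of_special (h.special hXext hT hT5) k hM, hM.2⟩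
  · exact fun M hM => ⟨h.fac_le M ⟨LeftRes.of_le hk hM.1, hM.2⟩, hM.2⟩

theorem PerpIsFac.closedByQuotients (h : s.PerpIsFac n X T) (hXext : s.ClosedUnderExtensions X)
    (hT : T = T.retractClosure) (hT5 : T5 E X T) :
    s.ClosedByQuotients n X (rightPerp E T ⊓ X) := by
  refine ⟨inf_le_right, fun B hB hr => ⟨h.fac_le B ⟨?_, hB⟩, hB⟩⟩
  exact fac_of_leftRes hXext (h.special hXext hT hT5) n hr

theorem perpIsFac_of_closedByQuotients (hq : s.ClosedByQuotients n X (rightPerp E T ⊓ X))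
    (h₁ : T ⊓ X ≤ rightPerp E T ⊓ X) (h₂ : rightPerp E T ⊓ X ≤ s.Fac X T 1) :
    s.PerpIsFac n X T where
  le_perp M hM := (h₁ M hM).1
  perp_le := h₂
  fac_le M hM := (hq.2 M hM.2 (hM.1.mono h₁)).1

/-! ### From tilting classes to factor classes -/

theorem succExtVanishes_of_pd_le (h : pd E X T ≤ n) {Z A : C} (hZ : T Z) (hA : X A) {i : ℕ}
    (hi : n < i + 1) : SuccExtVanishes E i Z A := by
  have h1 : pdObj E X Z ≤ n := (le_iSup₂ (f := fun (Z : C) (_ : T Z) => pdObj E X Z) Z hZ).trans h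
  -- A strict bound is needed to extract from the infimum an actual admissible `m ≤ n`.
  have h2 : pdObj E X Z < (n + 1 : ℕ) := lt_of_le_of_lt h1 (by exact_mod_cast Nat.lt_succ_self n)
  simp only [pdObj, iInf_lt_iff] at h2
  obtain ⟨m, hm, hmn⟩ := h2
  have hmn' : m < n + 1 := by exact_mod_cast hmn
  exact hm i (by omega) A hA

/-- Dimension shifting: each resolution step trades one unit of `m` for one degree, until the degree
exceeds `n`. -/
theorem succExtVanishes_of_leftRes (h : pd E X T ≤ n) (hTX : T ⊓ X ≤ rightPerp E T) {Z : C}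
    (hZ : T Z) : ∀ (m : ℕ) {B : C}, X B → s.Fac X T m B → ∀ i : ℕ, n < i + 1 + m →
      SuccExtVanishes E i Z B
  | 0, _, hB, _, _, hi => succExtVanishes_of_pd_le h hZ hB hi
  | m + 1, _, _, ⟨_, Y, hr, hY, hK, hf⟩, i, hi =>
    succExtVanishes_right hr (hTX Y hY i Z hZ)
      (succExtVanishes_of_leftRes h hTX hZ m hK hf (i + 1) (by omega))

/-- Embed `M ⟶ I ⟶ M'` by (T4). As `𝔼(N, I) = 0`, a class comes from some `c : N ⟶ M'`; by induction
`𝔼(N', M') = 0`, so `c` extends to `Y` and the class comes from `𝔼(Y, M) = 0`. Since `M` changes to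
`M'`, it is quantified inside the induction. -/
theorem extn_subsingleton_of_finCores (hT4 : s.T4 X T) {N : C} (hN : s.FinCores X T N) :
    X N → ∀ {M : C}, (rightPerp E T ⊓ X) M → Subsingleton (Extn E N M) := by
  obtain ⟨α, hα, hαX, hgen⟩ := hT4
  induction hN with
  | @base N Y e hXY hTY =>
    intro _ M hM
    have := succExtVanishes_zero_iff.mp (hM.1 0 Y hTY)
    refine subsingleton_of_forall_eq 0 fun ε => ?_
    rw [← pull_id E _ _ ε, ← e.hom_inv_id, pull_comp,
      Subsingleton.elim (pull E e.inv M ε) 0, map_zero]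
  | @step N Y N' h hY hXN' hN' ih =>
    intro hXN M hM
    obtain ⟨I, M', hI, hαI, hXM'⟩ := hgen M hM.2
    have hM' : (rightPerp E T ⊓ X) M' := ⟨rightPerp_right hI hM.1 (hα I hαI).2, hXM'⟩
    have h1 := ih hXN' hM'
    have h2 := succExtVanishes_zero_iff.mp ((hα I hαI).1 0 N hXN)
    have h3 := succExtVanishes_zero_iff.mp (hM.1 0 Y hY)
    obtain ⟨x, y, δ, h⟩ := h
    obtain ⟨x', y', δ', h'⟩ := hI
    refine subsingleton_of_forall_eq 0 fun ε => ?_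
    obtain ⟨c, rfl⟩ := exists_pull_eq h' ε (Subsingleton.elim _ _)
    obtain ⟨c, rfl⟩ := exists_inflation_comp_eq h c (Subsingleton.elim _ _)
    rw [pull_comp, Subsingleton.elim (pull E c M δ') 0, map_zero]

theorem IsTilting.perpIsFac (h : s.IsTilting n X T) (hXext : s.ClosedUnderExtensions X)
    (hX : X = X.retractClosure) : s.PerpIsFac n X T where
  le_perp := h.t2
  fac_le M hM i Z hZ := succExtVanishes_of_leftRes h.t1 h.t2 hZ n hM.2 hM.1 i (by omega)
  perp_le M hM := by
    obtain ⟨ω, hω, hωX, hgen⟩ := h.t3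
    obtain ⟨A, W, hA, hW, hXA⟩ := hgen M hM.2
    cases hω W hW with
    | base e hXY hTY =>
      exact ⟨A, W, hA, ⟨prop_of_iso h.t0 e hTY, prop_of_iso hX e hXY⟩, hXA, trivial⟩
    | @step _ Y N hN hTY hXN hcores =>
      obtain ⟨L, hL, hL'⟩ :=
        exists_tri_of_extn_subsingleton hA hN (extn_subsingleton_of_finCores h.t4 hcores hXN hM)
      exact ⟨L, Y, hL, ⟨hTY, hXext _ _ _ hN (hωX W hW) hXN⟩, hXext _ _ _ hL' hXA hXN, trivial⟩

/-! ### From factor classes to tilting classes -/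

/-- The `m`-th cosyzygies of `A` in `𝒳` with respect to `𝒯^⊥ ∩ 𝒳`. -/
inductive IsCosyzygy (s : Extriangulation E) (X T : ObjectProperty C) (A : C) : ℕ → C → Prop
  | zero : IsCosyzygy s X T A 0 A
  | succ {m : ℕ} {N I N' : C} (hN : IsCosyzygy s X T A m N) (h : s.Tri N I N')
      (hI : (rightPerp E T ⊓ X) I) (hN' : X N') : IsCosyzygy s X T A (m + 1) N'

theorem exists_isCosyzygy (hT4 : s.T4 X T) {A : C} (hA : X A) :
    ∀ m : ℕ, ∃ N : C, s.IsCosyzygy X T A m N ∧ X N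
  | 0 => ⟨A, .zero, hA⟩
  | m + 1 => by
    obtain ⟨N, hN, hXN⟩ := exists_isCosyzygy hT4 hA m
    obtain ⟨α, hα, hαX, hgen⟩ := hT4
    obtain ⟨I, N', h, hI, hN'⟩ := hgen N hXN
    exact ⟨N', hN.succ h ⟨(hα I hI).2, hαX I hI⟩ hN', hN'⟩

theorem IsCosyzygy.leftRes {A N : C} {m : ℕ} (h : s.IsCosyzygy X T A m N) (hA : X A) :
    X N ∧ s.LeftRes X (rightPerp E T ⊓ X) m N := by
  induction h with
  | zero => exact ⟨hA, trivial⟩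
  | succ hN h hI hN' ih => exact ⟨hN', _, _, h, hI, ih.1, ih.2⟩

theorem IsCosyzygy.succExtVanishes {A N : C} {m : ℕ} (h : s.IsCosyzygy X T A m N) {Z : C}
    (hZ : T Z) : ∀ {i : ℕ}, SuccExtVanishes E i Z N → SuccExtVanishes E (i + m) Z A := by
  induction h with
  | zero => exact fun h => h
  | @succ m N I N' hN h hI hN' ih =>
    intro i hi
    rw [← Nat.add_assoc, Nat.add_right_comm]
    exact ih (succExtVanishes_left h hi (hI.1 (i + 1) Z hZ))

/-- To descend from `N'` to `N`, pull the cover `Q` back along `I ⟶ N'` to get `U ∈ 𝒯^⊥ ∩ 𝒳`, and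
take a special precover `T₀ ⟶ U`. The kernel `V` of `T₀ ⟶ U ⟶ Q` covers `N`, and `V ⟶ T₀ ⟶ Q`
prolongs the coresolution of `Q`. -/
theorem IsCosyzygy.exists_finCores_cover (hXext : s.ClosedUnderExtensions X)
    (hsp : ∀ M : C, (rightPerp E T ⊓ X) M →
      ∃ K T₁ : C, s.Tri K T₁ M ∧ (T ⊓ X) T₁ ∧ (rightPerp E T ⊓ X) K)
    {A N : C} {m : ℕ} (h : s.IsCosyzygy X T A m N)
    (hN : ∃ L Q : C, s.Tri L Q N ∧ (s.FinCores X T ⊓ X) Q ∧ (rightPerp E T ⊓ X) L) :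
    X A → ∃ L Q : C, s.Tri L Q A ∧ (s.FinCores X T ⊓ X) Q ∧ (rightPerp E T ⊓ X) L := by
  intro hA
  induction h with
  | zero => exact hN
  | @succ m N I N' hcos h hI hN' ih =>
    refine ih ?_
    obtain ⟨L, Q, hQ, hQX, hL⟩ := hN
    obtain ⟨U, hU, hU'⟩ := exists_pullback h hQ
    obtain ⟨K, T₀, hK, hT₀, hKP⟩ := hsp U (perp_middle hXext hU' hL hI)
    obtain ⟨V, hV, hV'⟩ := tri_comp_deflation hK hU
    exact ⟨K, V, hV', ⟨.step hV hT₀.1 hQX.2 hQX.1,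
      hXext _ _ _ hV' hKP.2 (hcos.leftRes hA).1⟩, hKP⟩

theorem PerpIsFac.cosyzygy_mem (h : s.PerpIsFac n X T) (hXext : s.ClosedUnderExtensions X)
    (hT : T = T.retractClosure) (hT5 : T5 E X T) {A N : C} (hA : X A)
    (hN : s.IsCosyzygy X T A n N) : (rightPerp E T ⊓ X) N :=
  (h.closedByQuotients hXext hT hT5).2 N (hN.leftRes hA).1 (hN.leftRes hA).2

theorem PerpIsFac.isTilting (h : s.PerpIsFac n X T) (hXext : s.ClosedUnderExtensions X)
    (hT : T = T.retractClosure) (hT4 : s.T4 X T) (hT5 : T5 E X T) : s.IsTilting n X T where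
  t0 := hT
  t1 := by
    refine iSup₂_le fun Z hZ => iInf₂_le n fun i hi A hA => ?_
    obtain ⟨N, hN, -⟩ := exists_isCosyzygy hT4 hA n
    -- The index `i` stands for degree `i + 1 > n`, so shifting by `n` still lands in positive
    -- degree on the cosyzygy.
    obtain ⟨j, rfl⟩ : ∃ j, i = j + n := ⟨i - n, by omega⟩
    exact hN.succExtVanishes hZ ((h.cosyzygy_mem hXext hT hT5 hA hN).1 j Z hZ)
  t2 := h.le_perp
  t3 := by
    refine ⟨s.FinCores X T ⊓ X, inf_le_left, inf_le_right, fun A hA => ?_⟩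
    obtain ⟨N, hN, -⟩ := exists_isCosyzygy hT4 hA n
    have hsp := h.special hXext hT hT5
    obtain ⟨L, Q, hQ, hQX, hL⟩ := hN.exists_finCores_cover hXext hsp (by
      obtain ⟨K, T₁, hK, hT₁, hKP⟩ := hsp N (h.cosyzygy_mem hXext hT hT5 hA hN)
      exact ⟨K, T₁, hK, ⟨.base (Iso.refl _) hT₁.2 hT₁.1, hT₁.2⟩, hKP⟩) hA
    exact ⟨L, Q, hQ, hQX, hL.2⟩
  t4 := hT4
  t5 := hT5

end Extriangulation

end Classes

end Extri

theorem theorem3p19 {C : Type u} [Category.{v} C] [Preadditive C] [HasZeroObject C]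
    [HasBinaryBiproducts C] (E : Cᵒᵖ ⥤ C ⥤ AddCommGrpCat.{w}) (s : Extri.Extriangulation E)
    (n : ℕ) (hn : 1 ≤ n) (X T : ObjectProperty C)
    (hX : X = X.retractClosure) (hXext : s.ClosedUnderExtensions X)
    (hT : T = T.retractClosure) (hT4 : s.T4 X T) (hT5 : Extri.T5 E X T) :
    List.TFAE [
      s.IsTilting n X T,
      s.Fac X T n ⊓ X = Extri.rightPerp E T ⊓ X,
      ∀ k : ℕ, n ≤ k → Extri.rightPerp E T ⊓ X = s.Fac X T k ⊓ X,
      s.ClosedByQuotients n X (Extri.rightPerp E T ⊓ X) ∧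
        T ⊓ X ≤ Extri.rightPerp E T ⊓ X ∧
        Extri.rightPerp E T ⊓ X ≤ s.Fac X T 1] := by
  tfae_have 1 → 3 := fun h k hk => (h.perpIsFac hXext hX).eq_fac hXext hT hT5 hk
  tfae_have 3 → 2 := fun h => (h n le_rfl).symm
  tfae_have 2 → 4 := fun h => by
    have h' := Extri.Extriangulation.perpIsFac_of_eq hn hX hT h
    exact ⟨h'.closedByQuotients hXext hT hT5, le_inf h'.le_perp inf_le_right, h'.perp_le⟩
  tfae_have 4 → 1 := fun ⟨hq, h₁, h₂⟩ =>
    (Extri.Extriangulation.perpIsFac_of_closedByQuotients hq h₁ h₂).isTilting hXext hT hT4 hT5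
  tfae_finish
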